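/- An \emph{arena} $\mathcal{A}=\langle S,\Sigma_E,\Sigma_A,\delta,\sim_E,\sim_A\rangle$ consists of a finite set $S$ of states, finite sets $\Sigma_E,\Sigma_A$ of actions of Eve and Adam, a map $\delta$ from $S\times\Sigma_E\times\Sigma_A$ to the probability distributions on $S$, and equivalence relations $\sim_E,\sim_A$ on $S$. Adam is \emph{more informed} than Eve if $\sim_A\subseteq\sim_E$. A \emph{strategy} of Eve (Adam) is a function $\phi:(S/_{\sim_E})^*\to\Sigma_E$ (resp. $\psi:(S/_{\sim_A})^*\to\Sigma_A$), applied to the sequence of classes of the states visited so far. A pair of strategies and an initial state $s_0$ determine a probability measure $\mathrm{Pr}_{s_0}^{\phi,\psi}$ on infinite plays. For $K,F\subseteq S$, $\phi$ is \emph{positively winning} in the reachability game $(\mathcal{A},K,F)$ if for every $s_0\in K$ and every strategy $\psi$ of Adam the probability $\mathrm{Pr}_{s_0}^{\phi,\psi}$ of visiting $F$ is positive. Let $\mathcal{T}=\langle Q,q_0,q_s,\delta_{\mathcal{T}},Act\rangle$ be a deterministic automaton with finite state set $Q$, initial state $q_0$, sink state $q_s$, transition function $\delta_{\mathcal{T}}:Q\times(\Sigma_E\times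 S/_{\sim_E})\to Q$ and $Act:Q\to 2^{\Sigma_E}$, such that $Act(q)=\emptyset$ iff $q=q_s$, and $\delta_{\mathcal{T}}(q,(\sigma,x))=q_s$ iff $\sigma\notin Act(q)$. A partial play $\lambda=s_0(\sigma_E^0,\sigma_A^0)s_1\cdots s_k$ (every step having positive probability) leads $\mathcal{T}$ from $q_0$ to the state $q_\lambda$ by reading $(\sigma_E^0,[s_1]_{\sim_E})\cdots(\sigma_E^{k-1},[s_k]_{\sim_E})$. A strategy $\phi$ of Eve is \emph{$\mathcal{T}$-compatible} if $\phi(\lambda)\in Act(q_\lambda)$ for every partial play $\lambda$ that starts in $K$ and in which Eve respects $\phi$. \textbf{Theorem.} Consider inputs $(\mathcal{A},\mathcal{T},K,F)$ as above in which Adam is more informed than Eve; the input is given by explicit tables, and the probabilities are written in any code in which one can recognise in one step whether a probability is $0$. (1) There is an algorithm that decides whether Eve has a $\mathcal{T}$-compatible strategy that is positively winning in the reachability game $(\mathcal{A},K,F)$, and whose running time is polynomial in $2^{2^{|S|}}$, $|Q|$, $|\Sigma_E|$ and $|\Sigma_A|$. (2) There is an algorithm that, whenever such a strategy exists, constructs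 a finite automaton with output that computes one, and whose number of states (the memory) is bounded by a polynomial in $2^{2^{|S|}}$ and $|Q|$; the memory is thus polynomial in $|Q|$, doubly exponential in $|S|$, and bounded independently of $\Sigma_E$ and $\Sigma_A$. Here an algorithm is a program over binary trees with the constant \texttt{nil}, pairing, left and right subtree, composition, branching and while loops on tests for \texttt{nil}, every operation being one step. -/

import Mathlib

open MeasureTheory ProbabilityTheory
open scoped ENNReal

noncomputable section

/-! ### Concurrent arenas with imperfect information -/

/-- A concurrent arena with imperfect information: states `S`, actions `ActE` of Eve and `ActA` of
Adam, a total stochastic transition function and, for each player, the equivalence relation of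
the states which that player cannot distinguish. -/
structure Arena (S ActE ActA : Type*) where
  δ : S → ActE → ActA → PMF S
  simE : Setoid S
  simA : Setoid S

/-- A partial play: a state, followed by finitely many triples consisting of an action of Eve,
an action of Adam and a successor state. -/
inductive PartialPlay (S ActE ActA : Type*) where
  | start (s : S) : PartialPlay S ActE ActA
  | snoc (l : PartialPlay S ActE ActA) (e : ActE) (a : ActA) (s : S) : PartialPlay S ActE ActA

namespace PartialPlay

variable {S ActE ActA : Type*}

/-- The initial state. -/
def first : PartialPlay S ActE ActA → S
  | start s => s
  | snoc l _ _ _ => l.first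

/-- The current (last) state. -/
def last : PartialPlay S ActE ActA → S
  | start s => s
  | snoc _ _ _ s => s

/-- The sequence, in chronological order, of the classes of the states that were visited. -/
def obs (r : Setoid S) : PartialPlay S ActE ActA → List (Quotient r)
  | start s => [Quotient.mk r s]
  | snoc l _ _ s => l.obs r ++ [Quotient.mk r s]

/-- All steps have positive probability. -/
def IsPlay (A : Arena S ActE ActA) : PartialPlay S ActE ActA → Prop
  | start _ => True
  | snoc l e a s => l.IsPlay A ∧ 0 < A.δ l.last e a s

/-- Every action of Eve is the one that the pure strategy `φ` prescribes. -/
def EveRespects (A : Arena S ActE ActA) (φ : List (Quotient A.simE) → ActE) :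
    PartialPlay S ActE ActA → Prop
  | start _ => True
  | snoc l e _ _ => l.EveRespects A φ ∧ e = φ (l.obs A.simE)

end PartialPlay

namespace Arena

variable {S ActE ActA : Type*} (A : Arena S ActE ActA)

/-- Adam is more informed than Eve: `∼A ⊆ ∼E`. -/
def AdamMoreInformed : Prop := ∀ s t : S, A.simA s t → A.simE s t

/-- An observation-based pure strategy of Eve. -/
abbrev EveStrategy : Type _ := List (Quotient A.simE) → ActE

/-- An observation-based pure strategy of Adam. -/
abbrev AdamStrategy : Type _ := List (Quotient A.simA) → ActA

/-- The observations, in chronological order, along a state history `s₀, …, s_k`. -/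
def obsHistory (r : Setoid S) (k : ℕ) (h : Finset.Iic k → S) : List (Quotient r) :=
  List.ofFn fun i : Fin (k + 1) =>
    Quotient.mk r (h ⟨i, Finset.mem_Iic.2 (Nat.lt_succ_iff.1 i.2)⟩)

/-- The infinite play whose states are given by `ω` and whose actions are those prescribed by
the two strategies. The entry at position `i` is `(sᵢ, σEⁱ, σAⁱ)`. -/
def playOf (φ : A.EveStrategy) (ψ : A.AdamStrategy) (ω : ℕ → S) : ℕ → S × ActE × ActA := fun k =>
  (ω k, φ (obsHistory A.simE k fun i => ω i), ψ (obsHistory A.simA k fun i => ω i))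

/-- The reachability objective: the infinite plays that visit `F`. -/
def Reach (F : Set S) : Set (ℕ → S × ActE × ActA) := {p | ∃ k, (p k).1 ∈ F}

section Probability

variable [Finite S] [MeasurableSpace S] [DiscreteMeasurableSpace S]

/-- The transition probabilities from the state history `s₀, …, s_k` to `s_{k+1}` once both
pure strategies are fixed. -/
def stepKernel (φ : A.EveStrategy) (ψ : A.AdamStrategy) (k : ℕ) :
    Kernel (∀ _ : Finset.Iic k, S) S :=
  Kernel.ofFunOfCountable fun h =>
    (A.δ (h ⟨k, Finset.mem_Iic.2 le_rfl⟩) (φ (obsHistory A.simE k h))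
      (ψ (obsHistory A.simA k h))).toMeasure

instance (φ : A.EveStrategy) (ψ : A.AdamStrategy) (k : ℕ) :
    IsMarkovKernel (A.stepKernel φ ψ k) :=
  ⟨fun h => by
    change IsProbabilityMeasure (PMF.toMeasure _)
    infer_instance⟩

/-- The law of the state sequence of the play from `s₀` in which both players follow the given
pure strategies. -/
def stateLaw (s₀ : S) (φ : A.EveStrategy) (ψ : A.AdamStrategy) : Measure (ℕ → S) :=
  Kernel.traj (X := fun _ => S) (A.stepKernel φ ψ) 0 (fun _ => s₀)

/-- The probability that the play from `s₀` belongs to the objective `O`. As the strategies are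
pure, the play is a function of its state sequence. -/
def prob (s₀ : S) (φ : A.EveStrategy) (ψ : A.AdamStrategy) (O : Set (ℕ → S × ActE × ActA)) : ℝ≥0∞ :=
  A.stateLaw s₀ φ ψ {ω | A.playOf φ ψ ω ∈ O}

/-- `φ` is positively winning in the reachability game `(A, K, F)`. -/
def PositivelyWinning (K F : Set S) (φ : A.EveStrategy) : Prop :=
  ∀ s₀ ∈ K, ∀ ψ : A.AdamStrategy, 0 < A.prob s₀ φ ψ (Reach F)

end Probability

end Arena

/-! ### Automata that restrict the actions of Eve -/

/-- A deterministic automaton with states `Q` reading pairs (action of Eve, class of states) and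
giving in every state the set of allowed actions. -/
structure ActionAutomaton {S : Type*} (r : Setoid S) (ActE Q : Type*) where
  init : Q
  sink : Q
  next : Q → ActE × Quotient r → Q
  Act : Q → Set ActE
  act_eq_empty_iff : ∀ q, Act q = ∅ ↔ q = sink
  next_eq_sink_iff : ∀ q e x, next q (e, x) = sink ↔ e ∉ Act q

/-- The state reached by the automaton on a partial play. The first state of the play is not
read. -/
def ActionAutomaton.stateAfter {S ActE ActA Q : Type*} {r : Setoid S} (T : ActionAutomaton r ActE Q) :
    PartialPlay S ActE ActA → Q
  | .start _ => T.init
  | .snoc l e _ s => T.next (T.stateAfter l) (e, Quotient.mk r s)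

/-- `φ` is `T`-compatible in the game started in `K`: after every partial play from `K` in which
Eve respects `φ`, the next action chosen by `φ` is allowed by `T`. -/
def Arena.Compatible {S ActE ActA Q : Type*} (A : Arena S ActE ActA) (T : ActionAutomaton A.simE ActE Q)
    (K : Set S) (φ : A.EveStrategy) : Prop :=
  ∀ l : PartialPlay S ActE ActA, l.first ∈ K → l.IsPlay A → l.EveRespects A φ →
    φ (l.obs A.simE) ∈ T.Act (T.stateAfter l)

/-! ### Finite-memory strategies -/

/-- A finite automaton with output, with `k` states, that reads observations and outputs
actions. -/
structure MemoryAutomaton {S : Type*} (r : Setoid S) (ActE : Type*) (k : ℕ) where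
  init : Fin k
  next : Fin k → Quotient r → Fin k
  out : Fin k → ActE

/-- The strategy computed by the automaton: the output of the state reached after reading the
sequence of observations. -/
def MemoryAutomaton.strategy {S ActE : Type*} {r : Setoid S} {k : ℕ} (M : MemoryAutomaton r ActE k) :
    List (Quotient r) → ActE :=
  fun w => M.out (w.foldl M.next M.init)

/-! ### Programs and their running time -/

/-- Data of programs: binary trees. -/
inductive Data where
  | nil : Data
  | node (l r : Data) : Data

/-- Left subtree, with value `nil` on `nil`. -/
def Data.left : Data → Data
  | nil => nil
  | node l _ => l

/-- Right subtree, with value `nil` on `nil`. -/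
def Data.right : Data → Data
  | nil => nil
  | node _ r => r

/-- Structured programs working on one binary tree (a WHILE language over trees with one
variable). The basic operations are the constant `nil`, the two subtrees, and joining two trees;
the only tests are tests for `nil`. -/
inductive Prog where
  | id : Prog
  | nil : Prog
  | left : Prog
  | right : Prog
  | pair (f g : Prog) : Prog
  | seq (f g : Prog) : Prog
  | cond (c f g : Prog) : Prog
  | loop (c f : Prog) : Prog

/-- `Run P x y t`: on input `x` the program `P` halts with output `y` after exactly `t` steps.
Each elementary operation and each control operation is one step (trees are shared, not copied,
so that an elementary operation changes a bounded number of pointers).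
`cond c f g` runs `f` if `c` gives a tree other than `nil`, and `g` otherwise;
`loop c f` is `while c (x) ≠ nil do x := f (x)`. -/
inductive Run : Prog → Data → Data → ℕ → Prop where
  | id (x : Data) : Run .id x x 1
  | nil (x : Data) : Run .nil x .nil 1
  | left (x : Data) : Run .left x x.left 1
  | right (x : Data) : Run .right x x.right 1
  | pair {f g : Prog} {x y z : Data} {s t : ℕ} :
      Run f x y s → Run g x z t → Run (.pair f g) x (.node y z) (s + t + 1)
  | seq {f g : Prog} {x y z : Data} {s t : ℕ} :
      Run f x y s → Run g y z t → Run (.seq f g) x z (s + t + 1)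
  | cond_true {c f g : Prog} {x u v y : Data} {s t : ℕ} :
      Run c x (.node u v) s → Run f x y t → Run (.cond c f g) x y (s + t + 1)
  | cond_false {c f g : Prog} {x y : Data} {s t : ℕ} :
      Run c x .nil s → Run g x y t → Run (.cond c f g) x y (s + t + 1)
  | loop_stop {c f : Prog} {x : Data} {s : ℕ} :
      Run c x .nil s → Run (.loop c f) x x (s + 1)
  | loop_step {c f : Prog} {x u v y z : Data} {s t r : ℕ} :
      Run c x (.node u v) s → Run f x y t → Run (.loop c f) y z r →
        Run (.loop c f) x z (s + t + r + 1)

/-! ### Encoding of inputs and outputs -/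

namespace Data

/-- Lists of trees as trees. -/
def ofList : List Data → Data
  | [] => nil
  | x :: l => node x (ofList l)

/-- Natural numbers in unary. -/
def ofNat : ℕ → Data
  | 0 => nil
  | n + 1 => node nil (ofNat n)

open Classical in
/-- Truth values: false is `nil`, true is `node nil nil`. -/
def ofProp (p : Prop) : Data := if p then node nil nil else nil

/-- The table of values of a function on `Fin n`. -/
def table {n : ℕ} (f : Fin n → Data) : Data := ofList (List.ofFn f)

end Data

/-- The encoding of the input: the numbers of states and actions and of states of the automaton,
followed by tables of all components of the arena, of the sets `K` and `F`, and of the automaton.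
Classes of states are given through their elements, and a probability `p` is written as
`code p`. -/
def encodeGame (code : ℝ≥0∞ → Data) {n a b m : ℕ} (A : Arena (Fin n) (Fin a) (Fin b))
    (T : ActionAutomaton A.simE (Fin a) (Fin m)) (K F : Set (Fin n)) : Data :=
  .ofList
    [.ofNat n, .ofNat a, .ofNat b, .ofNat m,
      .table fun s => .table fun e => .table fun c => .table fun s' => code (A.δ s e c s'),
      .table fun s => .table fun s' => .ofProp (A.simE s s'),
      .table fun s => .table fun s' => .ofProp (A.simA s s'),
      .table fun s => .ofProp (s ∈ K),
      .table fun s => .ofProp (s ∈ F),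
      .ofNat (T.init : ℕ),
      .ofNat (T.sink : ℕ),
      .table fun q => .table fun e => .table fun s =>
        .ofNat (T.next q (e, Quotient.mk A.simE s) : ℕ),
      .table fun q => .table fun e => .ofProp (e ∈ T.Act q)]

/-- The encoding of a finite-memory strategy: number of memory states, initial memory state,
table of the transitions (the class that is read is given through its elements) and table of the
outputs. -/
def encodeMemory {n a k : ℕ} {r : Setoid (Fin n)} (M : MemoryAutomaton r (Fin a) k) : Data :=
  .ofList
    [.ofNat k,
      .ofNat (M.init : ℕ),
      .table fun i => .table fun s => .ofNat (M.next i (Quotient.mk r s) : ℕ),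
      .table fun i => .ofNat (M.out i : ℕ)]

/-- Eve has a `T`-compatible strategy that is positively winning in `(A, K, F)`. -/
def EveWins {n a b m : ℕ} (A : Arena (Fin n) (Fin a) (Fin b))
    (T : ActionAutomaton A.simE (Fin a) (Fin m)) (K F : Set (Fin n)) : Prop :=
  ∃ φ : A.EveStrategy, A.Compatible T K φ ∧ A.PositivelyWinning K F φ

end

/-!
# Positively winning strategies in concurrent reachability games with imperfect information

*The game on families of beliefs.* Fix a strategy `φ` of Eve. As Adam is more informed than Eve, he
knows her observations, hence her actions, and his knowledge of the play is a belief: the set of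
states compatible with his observations. `φ` fails to be positively winning from `s₀` exactly if
Adam can choose his actions such that no belief that may arise meets `F`. He does not control his
observations, so he must survive all of them; Eve succeeds if for each of his choices there is one
observation after which she still wins. Eve does not see the belief. What matters for her is
therefore a *family* of beliefs, all compatible with her own observations, that she has to defeat
simultaneously. A move from the position `(q, fam)` consists of an action `e` allowed by the
automaton in state `q` and a new family `fam'` that contains, for each belief in `fam` that does not
meet `F` and for each action of Adam, a possible next belief (`Secured`, `CanMove`); her next
observation then selects the part of `fam'` compatible with it (`Covers`). Adam has finitely many
actions and there are finitely many observations, so a winning strategy defeats every initial belief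
within a bounded number of steps (`exists_action_of_not_winsWithin`, `exists_winsWithin`), and Eve
wins if and only if she can force the empty family. This is a reachability game with `m * 2 ^ 2 ^ n`
positions, and its attractor is computed by a loop.

*Correctness.* The attractor is a list of entries, each of which records a move to earlier entries.
Reading it as an automaton gives a finite-memory strategy; induction on the number of the entry shows
that it is positively winning (`exists_reach_of_atEntry`). Conversely the attractor is closed under
moves, since every round of the loop adds a position unless it is closed already
(`isClosedAttr_attractor`); induction on the number of steps within which a winning strategy defeats
a family shows that the attractor covers this family (`exists_entry_of_winsWithin`). Positive
probability enters only through `Arena.prob_reach_pos` and `Arena.exists_play_of_prob_pos`: the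
probability of reaching `F` is positive if and only if some play with possible steps reaches `F`.

*Running time.* `PolyComp N enc f` says that one program computes `f i` from `enc i` in time
polynomial in `N i`, for all `i` in an index type. The class is closed under substitution, branching,
folds over lists (`PolyComp.foldl`), bounded quantifiers, and tables. The attractor is defined by
such constructions, with quantifiers over states, actions, sets of states and families of sets, so
no program has to be written down. The number of times a position is processed is polynomial as well,
which is why entries may be repeated without harm.
-/

noncomputable section

/-! ### Polynomially bounded quantities -/

/-- `T` is bounded by a polynomial in the size measure `N`. Up to a change of the exponent, every
polynomial bound has the form used here. -/
def PolyBdd {I : Type} (N T : I → ℕ) : Prop := ∃ d, ∀ i, T i ≤ (N i + 2) ^ d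

namespace PolyBdd

variable {I J : Type} {N T T' : I → ℕ}

theorem mono (h : PolyBdd N T') (hle : ∀ i, T i ≤ T' i) : PolyBdd N T :=
  let ⟨d, hd⟩ := h
  ⟨d, fun i => (hle i).trans (hd i)⟩

theorem const (c : ℕ) : PolyBdd N fun _ => c :=
  ⟨c, fun i => (Nat.lt_pow_self (by omega)).le⟩

theorem self : PolyBdd N N := ⟨1, fun i => by simp⟩

theorem add (h : PolyBdd N T) (h' : PolyBdd N T') : PolyBdd N fun i => T i + T' i := by
  obtain ⟨d, hd⟩ := h
  obtain ⟨d', hd'⟩ := h'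
  refine ⟨d + d' + 1, fun i => ?_⟩
  have h1 : (N i + 2) ^ d ≤ (N i + 2) ^ (d + d') := Nat.pow_le_pow_right (by omega) (by omega)
  have h2 : (N i + 2) ^ d' ≤ (N i + 2) ^ (d + d') := Nat.pow_le_pow_right (by omega) (by omega)
  have h3 : (N i + 2) ^ (d + d' + 1) = (N i + 2) ^ (d + d') * (N i + 2) := pow_succ _ _
  have := hd i
  have := hd' i
  nlinarith

theorem mul (h : PolyBdd N T) (h' : PolyBdd N T') : PolyBdd N fun i => T i * T' i := by
  obtain ⟨d, hd⟩ := h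
  obtain ⟨d', hd'⟩ := h'
  exact ⟨d + d', fun i => by rw [pow_add]; exact Nat.mul_le_mul (hd i) (hd' i)⟩

theorem comp (r : J → I) (h : PolyBdd N T) : PolyBdd (fun j => N (r j)) fun j => T (r j) :=
  let ⟨d, hd⟩ := h
  ⟨d, fun j => hd (r j)⟩

end PolyBdd

theorem Data.ofProp_of {p : Prop} (h : p) : Data.ofProp p = .node .nil .nil := if_pos h

theorem Data.ofProp_of_not {p : Prop} (h : ¬ p) : Data.ofProp p = .nil := if_neg h

/-! ### Functions computed in polynomial time, uniformly in a family of instances -/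

/-- One program computes `f i` from `enc i` for every index `i`, in time polynomial in `N i`. The
tree `enc i` is the current environment: local variables are stacked on top of the input, and `i`
ranges over the possible values of all of them. -/
def PolyComp {I : Type} (N : I → ℕ) (enc f : I → Data) : Prop :=
  ∃ (P : Prog) (T : I → ℕ), PolyBdd N T ∧ ∀ i, ∃ t ≤ T i, Run P (enc i) (f i) t

namespace PolyComp

variable {I J : Type} {N : I → ℕ} {enc f g : I → Data}

theorem congr (h : PolyComp N enc f) (hfg : ∀ i, f i = g i) : PolyComp N enc g :=
  (funext hfg : f = g) ▸ h

theorem env : PolyComp N enc enc := ⟨.id, fun _ => 1, .const 1, fun _ => ⟨1, le_rfl, .id _⟩⟩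

theorem nil : PolyComp N enc fun _ => .nil :=
  ⟨.nil, fun _ => 1, .const 1, fun _ => ⟨1, le_rfl, .nil _⟩⟩

theorem pair (hf : PolyComp N enc f) (hg : PolyComp N enc g) :
    PolyComp N enc fun i => .node (f i) (g i) := by
  obtain ⟨P, T, hT, hP⟩ := hf
  obtain ⟨Q, U, hU, hQ⟩ := hg
  refine ⟨.pair P Q, fun i => T i + U i + 1, (hT.add hU).add (.const 1), fun i => ?_⟩
  obtain ⟨t, ht, hPt⟩ := hP i
  obtain ⟨u, hu, hQu⟩ := hQ i
  exact ⟨_, by dsimp only; omega, .pair hPt hQu⟩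

/-- Substitution: a function of the environment `enc` may be applied to any environment of that
form which can be computed. -/
theorem lift {enc' : J → Data} {r : J → I} (h : PolyComp N enc f)
    (h' : PolyComp (fun j => N (r j)) enc' fun j => enc (r j)) :
    PolyComp (fun j => N (r j)) enc' fun j => f (r j) := by
  obtain ⟨P, T, hT, hP⟩ := h
  obtain ⟨Q, U, hU, hQ⟩ := h'
  refine ⟨.seq Q P, fun j => U j + T (r j) + 1, (hU.add (hT.comp r)).add (.const 1), fun j => ?_⟩
  obtain ⟨t, ht, hPt⟩ := hP (r j)
  obtain ⟨u, hu, hQu⟩ := hQ j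
  exact ⟨_, by dsimp only; omega, .seq hQu hPt⟩

theorem left (h : PolyComp N enc f) : PolyComp N enc fun i => (f i).left := by
  obtain ⟨P, T, hT, hP⟩ := h
  refine ⟨.seq P .left, fun i => T i + 2, hT.add (.const 2), fun i => ?_⟩
  obtain ⟨t, ht, hPt⟩ := hP i
  exact ⟨_, by dsimp only; omega, .seq hPt (.left _)⟩

theorem right (h : PolyComp N enc f) : PolyComp N enc fun i => (f i).right := by
  obtain ⟨P, T, hT, hP⟩ := h
  refine ⟨.seq P .right, fun i => T i + 2, hT.add (.const 2), fun i => ?_⟩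
  obtain ⟨t, ht, hPt⟩ := hP i
  exact ⟨_, by dsimp only; omega, .seq hPt (.right _)⟩

open Classical in
theorem ite {p : I → Prop} (hp : PolyComp N enc fun i => .ofProp (p i)) (hf : PolyComp N enc f)
    (hg : PolyComp N enc g) : PolyComp N enc fun i => if p i then f i else g i := by
  obtain ⟨P, T, hT, hP⟩ := hf
  obtain ⟨Q, U, hU, hQ⟩ := hg
  obtain ⟨R, V, hV, hR⟩ := hp
  refine ⟨.cond R P Q, fun i => V i + (T i + U i) + 1, (hV.add (hT.add hU)).add (.const 1),
    fun i => ?_⟩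
  obtain ⟨t, ht, hPt⟩ := hP i
  obtain ⟨u, hu, hQu⟩ := hQ i
  obtain ⟨v, hv, hRv⟩ := hR i
  by_cases h : p i
  · replace hRv : Run R (enc i) (.node .nil .nil) v := Data.ofProp_of h ▸ hRv
    exact ⟨v + t + 1, by dsimp only; omega, by dsimp only; rw [if_pos h]; exact .cond_true hRv hPt⟩
  · replace hRv : Run R (enc i) .nil v := Data.ofProp_of_not h ▸ hRv
    exact ⟨v + u + 1, by dsimp only; omega, by dsimp only; rw [if_neg h]; exact .cond_false hRv hQu⟩

theorem true : PolyComp N enc fun _ => .ofProp True :=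
  (nil.pair nil).congr fun i => by simp [Data.ofProp]

theorem ne_nil (h : PolyComp N enc f) : PolyComp N enc fun i => .ofProp (f i ≠ .nil) := by
  obtain ⟨R, V, hV, hR⟩ := h
  refine ⟨.cond R (.pair .nil .nil) .nil, fun i => V i + 4, hV.add (.const 4), fun i => ?_⟩
  obtain ⟨v, hv, hRv⟩ := hR i
  cases h : f i with
  | nil =>
    rw [h] at hRv
    refine ⟨v + 1 + 1, by dsimp only; omega, ?_⟩
    change Run _ _ (Data.ofProp (f i ≠ .nil)) _
    rw [Data.ofProp_of_not (by simp [h])]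
    exact .cond_false hRv (.nil _)
  | node a b =>
    rw [h] at hRv
    refine ⟨v + 3 + 1, by dsimp only; omega, ?_⟩
    change Run _ _ (Data.ofProp (f i ≠ .nil)) _
    rw [Data.ofProp_of (by simp [h])]
    exact .cond_true hRv (.pair (.nil _) (.nil _))

section Connectives

variable {p q : I → Prop}

theorem congr_prop (h : PolyComp N enc fun i => .ofProp (p i)) (hpq : ∀ i, p i ↔ q i) :
    PolyComp N enc fun i => .ofProp (q i) :=
  h.congr fun i => by rw [propext (hpq i)]

theorem not (h : PolyComp N enc fun i => .ofProp (p i)) :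
    PolyComp N enc fun i => .ofProp (¬ p i) :=
  (ite h nil true).congr fun i => by by_cases h : p i <;> simp [h, Data.ofProp]

theorem and (h : PolyComp N enc fun i => .ofProp (p i))
    (h' : PolyComp N enc fun i => .ofProp (q i)) :
    PolyComp N enc fun i => .ofProp (p i ∧ q i) :=
  (ite h h' nil).congr fun i => by
    by_cases h : p i
    · simp [h]
    · rw [if_neg h, Data.ofProp_of_not (by tauto)]

theorem or (h : PolyComp N enc fun i => .ofProp (p i))
    (h' : PolyComp N enc fun i => .ofProp (q i)) :
    PolyComp N enc fun i => .ofProp (p i ∨ q i) :=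
  (ite h true h').congr fun i => by
    by_cases h : p i
    · rw [if_pos h, Data.ofProp_of trivial, Data.ofProp_of (by tauto)]
    · simp [h]

theorem imp (h : PolyComp N enc fun i => .ofProp (p i))
    (h' : PolyComp N enc fun i => .ofProp (q i)) :
    PolyComp N enc fun i => .ofProp (p i → q i) :=
  (h.not.or h').congr_prop fun i => by tauto

theorem iff (h : PolyComp N enc fun i => .ofProp (p i))
    (h' : PolyComp N enc fun i => .ofProp (q i)) :
    PolyComp N enc fun i => .ofProp (p i ↔ q i) :=
  ((h.imp h').and (h'.imp h)).congr_prop fun i => by tauto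

end Connectives

/-! ### Loops over lists -/

/-- The body of the loop that folds a program over a list. The loop works on a tree
`(list, (accumulator, environment))`. -/
def foldBody (P : Prog) : Prog :=
  .pair (.seq .left .right)
    (.pair (.seq (.pair (.seq .left .left) .right) P) (.seq .right .right))

/-- The loop folds `f` over a list, if `P` computes `f` on the accumulators that occur. -/
theorem run_fold {α β : Type} (ea : α → Data) (eb : β → Data) (env : Data) (f : β → α → β)
    (P : Prog) (c : ℕ) (L : List α) : ∀ b : β,
    (∀ L₁ x L₂, L = L₁ ++ x :: L₂ → ∃ t ≤ c,
      Run P (.node (ea x) (.node (eb (L₁.foldl f b)) env)) (eb (f (L₁.foldl f b) x)) t) →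
    ∃ t ≤ L.length * (c + 20) + 2,
      Run (.loop .left (foldBody P)) (.node (.ofList (L.map ea)) (.node (eb b) env))
        (.node .nil (.node (eb (L.foldl f b)) env)) t := by
  induction L with
  | nil => exact fun b _ => ⟨2, by simp, Run.loop_stop (.left _)⟩
  | cons x L ih =>
    intro b h
    obtain ⟨t, ht, hP⟩ := h [] x L rfl
    obtain ⟨u, hu, hR⟩ := ih (f b x) fun L₁ y L₂ hL => by
      simpa using h (x :: L₁) y L₂ (by simp [hL])
    refine ⟨_, ?_, .loop_step (.left _)
      (.pair (.seq (.left _) (.right _))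
        (.pair (.seq (.pair (.seq (.left _) (.left _)) (.right _)) hP)
          (.seq (.right _) (.right _)))) hR⟩
    simp only [List.length_cons]
    ring_nf at hu ⊢
    omega

/-- Folds. In the hypothesis on the body, `enc'` is the environment inside the loop, `x` the
current element of the list and `acc` the accumulator, of which it may be assumed that it arises
from a prefix of the list. -/
theorem foldl {α β : I → Type} {ea : ∀ i, α i → Data} {eb : ∀ i, β i → Data}
    {L : ∀ i, List (α i)} {F : ∀ i, β i → α i → β i} {b : ∀ i, β i}
    (hL : PolyComp N enc fun i => .ofList ((L i).map (ea i)))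
    (hlen : PolyBdd N fun i => (L i).length)
    (hb : PolyComp N enc fun i => eb i (b i))
    (hF : ∀ (J : Type) (r : J → I) (enc' : J → Data) (x : ∀ j, α (r j)) (acc : ∀ j, β (r j)),
      (∀ j, x j ∈ L (r j)) →
      (∀ j, ∃ L₁, L₁ <+: L (r j) ∧ acc j = L₁.foldl (F (r j)) (b (r j))) →
      PolyComp (fun j => N (r j)) enc' (fun j => enc (r j)) →
      PolyComp (fun j => N (r j)) enc' (fun j => ea (r j) (x j)) →
      PolyComp (fun j => N (r j)) enc' (fun j => eb (r j) (acc j)) →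
      PolyComp (fun j => N (r j)) enc' (fun j => eb (r j) (F (r j) (acc j) (x j)))) :
    PolyComp N enc fun i => eb i ((L i).foldl (F i) (b i)) := by
  let K : I → Type := fun i => {p : α i × β i // p.1 ∈ L i ∧
    ∃ L₁, L₁ <+: L i ∧ p.2 = L₁.foldl (F i) (b i)}
  let encK : (Σ i, K i) → Data := fun j =>
    .node (ea j.1 j.2.1.1) (.node (eb j.1 j.2.1.2) (enc j.1))
  have he : PolyComp (fun j : Σ i, K i => N j.1) encK encK := env
  obtain ⟨P, T, ⟨d, hd⟩, hP⟩ := hF (Σ i, K i) Sigma.fst encK (fun j => j.2.1.1) (fun j => j.2.1.2)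
    (fun j => j.2.2.1) (fun j => j.2.2.2) he.right.right he.left he.right.left
  obtain ⟨PL, TL, hTL, hPL⟩ := hL
  obtain ⟨Pb, Tb, hTb, hPb⟩ := hb
  refine ⟨.seq (.pair PL (.pair Pb .id)) (.seq (.loop .left (foldBody P)) (.seq .right .left)),
    fun i => (TL i + Tb i) + ((L i).length * ((N i + 2) ^ d + 20) + 20),
    (hTL.add hTb).add ((hlen.mul (PolyBdd.add ⟨d, fun i => le_rfl⟩ (.const 20))).add (.const 20)),
    fun i => ?_⟩
  obtain ⟨t, ht, hL⟩ := hPL i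
  obtain ⟨u, hu, hb⟩ := hPb i
  obtain ⟨v, hv, hR⟩ := run_fold (ea i) (eb i) (enc i) (F i) P ((N i + 2) ^ d) (L i) (b i) (by
    intro L₁ x L₂ hL
    obtain ⟨t, ht, h⟩ := hP ⟨i, (x, L₁.foldl (F i) (b i)), by simp [hL], L₁, ⟨_, hL.symm⟩, rfl⟩
    exact ⟨t, ht.trans (hd _), h⟩)
  exact ⟨_, by dsimp only; omega, .seq (.pair hL (.pair hb (.id _))) (.seq hR (.seq (.right _) (.left _)))⟩

end PolyComp

/-! ### Lists and tables as trees -/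

theorem Data.ofNat_eq_ofList (n : ℕ) :
    Data.ofNat n = .ofList ((List.replicate n ()).map fun _ => .nil) := by
  induction n with
  | zero => rfl
  | succ n ih => rw [Data.ofNat, ih, List.replicate_succ, List.map_cons, Data.ofList]

theorem Data.table_eq_ofList {n : ℕ} (f : Fin n → Data) :
    Data.table f = .ofList ((List.finRange n).map f) := by
  rw [Data.table, List.ofFn_eq_map]

theorem Data.left_right_table {n : ℕ} (f : Fin n → Data) (s : Fin n) :
    (Data.right^[(s : ℕ)] (.table f)).left = f s := by
  have key : ∀ (l : List Data) (k : ℕ) (h : k < l.length),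
      (Data.right^[k] (.ofList l)).left = l[k] := by
    intro l
    induction l with
    | nil => simp
    | cons x l ih =>
      intro k h
      cases k with
      | zero => rfl
      | succ k => exact ih k (by simpa using h)
  rw [Data.table, key _ _ (by simp)]
  simp

theorem Data.right_ofNat (n k : ℕ) : Data.right^[k] (.ofNat n) = .ofNat (n - k) := by
  induction k generalizing n with
  | zero => rfl
  | succ k ih => cases n with
    | zero => simpa [Data.ofNat, Data.right] using ih 0
    | succ n => simpa [Data.ofNat, Data.right] using ih n

/-! ### Searching a list, and the list of all sublists -/

open Classical in
/-- The value of `f` at the last element of the list `L` that satisfies `p`, and `d` if there is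
none. -/
def List.lastSat {α β : Type} (L : List α) (p : α → Prop) (f : α → β) (d : β) : β :=
  L.foldl (fun acc x => if p x then f x else acc) d

section LastSat

variable {α β : Type} {p : α → Prop} {f : α → β} {d : β}

theorem List.lastSat_append_singleton (L : List α) (x : α) :
    (L ++ [x]).lastSat p f d = open Classical in if p x then f x else L.lastSat p f d := by
  simp [List.lastSat]

theorem List.lastSat_cases (L : List α) :
    (∃ x ∈ L, p x ∧ L.lastSat p f d = f x) ∨ ((∀ x ∈ L, ¬ p x) ∧ L.lastSat p f d = d) := by
  induction L using List.reverseRecOn with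
  | nil => exact .inr ⟨by simp, rfl⟩
  | append_singleton L x ih =>
    rw [List.lastSat_append_singleton]
    by_cases hx : p x
    · exact .inl ⟨x, by simp, hx, if_pos hx⟩
    · rw [if_neg hx]
      obtain ⟨y, hy, h⟩ | ⟨h, h'⟩ := ih
      · exact .inl ⟨y, by simp [hy], h⟩
      · refine .inr ⟨fun y hy => ?_, h'⟩
        obtain hy | rfl : y ∈ L ∨ y = x := by simpa using hy
        · exact h y hy
        · exact hx

theorem List.exists_lastSat_eq {L : List α} (h : ∃ x ∈ L, p x) :
    ∃ x ∈ L, p x ∧ L.lastSat p f d = f x := by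
  obtain h' | h' := List.lastSat_cases (p := p) (f := f) (d := d) L
  · exact h'
  · obtain ⟨x, hx, hpx⟩ := h
    exact absurd hpx (h'.1 x hx)

end LastSat

/-- All sublists of a list, as computed by a loop over its elements. -/
def List.powList {α : Type} (L : List α) : List (List α) :=
  L.foldl (fun acc x => acc ++ acc.map (List.cons x)) [[]]

section PowList

variable {α : Type}

theorem List.powList_append_singleton (L : List α) (x : α) :
    (L ++ [x]).powList = L.powList ++ L.powList.map (List.cons x) := by
  simp [List.powList]

theorem List.length_powList (L : List α) : L.powList.length = 2 ^ L.length := by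
  induction L using List.reverseRecOn with
  | nil => rfl
  | append_singleton L x ih =>
    rw [List.powList_append_singleton]
    simp [ih, pow_succ, mul_two]

theorem List.mem_powList_length {L X : List α} (h : X ∈ L.powList) :
    X.length ≤ L.length := by
  induction L using List.reverseRecOn generalizing X with
  | nil => simp_all [List.powList]
  | append_singleton L x ih =>
    rw [List.powList_append_singleton] at h
    simp only [List.mem_append, List.mem_map] at h
    obtain h | ⟨Y, hY, rfl⟩ := h
    · simpa using (ih h).trans (Nat.le_succ _)
    · simpa using ih hY

theorem List.mem_powList_subset {L X : List α} (h : X ∈ L.powList) : X ⊆ L := by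
  induction L using List.reverseRecOn generalizing X with
  | nil => simp_all [List.powList]
  | append_singleton L x ih =>
    rw [List.powList_append_singleton] at h
    simp only [List.mem_append, List.mem_map] at h
    obtain h | ⟨Y, hY, rfl⟩ := h
    · exact fun y hy => by simp [ih h hy]
    · intro y hy
      obtain rfl | hy := List.mem_cons.1 hy
      · simp
      · simp [ih hY hy]

theorem List.nil_mem_powList (L : List α) : [] ∈ L.powList := by
  induction L using List.reverseRecOn with
  | nil => simp [List.powList]
  | append_singleton L x ih => simp [List.powList_append_singleton, ih]

theorem List.exists_mem_powList (L : List α) (p : α → Prop) :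
    ∃ X ∈ L.powList, ∀ x, x ∈ X ↔ x ∈ L ∧ p x := by
  induction L using List.reverseRecOn with
  | nil => exact ⟨[], by simp [List.powList], by simp⟩
  | append_singleton L x ih =>
    obtain ⟨X, hX, h⟩ := ih
    rw [List.powList_append_singleton]
    by_cases hx : p x
    · refine ⟨x :: X, by simp [hX], fun y => ?_⟩
      simp only [List.mem_cons, h, List.mem_append, List.not_mem_nil, or_false]
      constructor
      · rintro (rfl | h) <;> tauto
      · tauto
    · refine ⟨X, by simp [hX], fun y => ?_⟩
      simp only [List.mem_cons, h, List.mem_append, List.not_mem_nil, or_false]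
      constructor
      · tauto
      · rintro ⟨h | rfl, h'⟩ <;> tauto

end PowList

/-! ### List operations and bounded quantifiers -/

namespace PolyComp

variable {I J : Type} {N : I → ℕ} {enc f g : I → Data}

section Lists

variable {α β : I → Type} {ea : ∀ i, α i → Data} {eb : ∀ i, β i → Data} {L L' : ∀ i, List (α i)}

theorem cons {x : ∀ i, α i} (hx : PolyComp N enc fun i => ea i (x i))
    (hL : PolyComp N enc fun i => .ofList ((L i).map (ea i))) :
    PolyComp N enc fun i => .ofList ((x i :: L i).map (ea i)) :=
  (hx.pair hL).congr fun i => by simp [Data.ofList]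

theorem list_nil : PolyComp N enc fun i => .ofList (([] : List (α i)).map (ea i)) := nil

theorem foldl_cons_eq {γ : Type} (l l' : List γ) :
    l.foldl (fun acc x => x :: acc) l' = l.reverse ++ l' := by
  induction l generalizing l' with
  | nil => rfl
  | cons x l ih => simp [ih]

theorem reverse (hL : PolyComp N enc fun i => .ofList ((L i).map (ea i)))
    (hlen : PolyBdd N fun i => (L i).length) :
    PolyComp N enc fun i => .ofList ((L i).reverse.map (ea i)) :=
  (foldl (F := fun _ acc x => x :: acc) (b := fun _ => [])
    (eb := fun i (l : List (α i)) => .ofList (l.map (ea i))) hL hlen list_nil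
    fun _ _ _ _ _ _ _ _ hx hacc => hx.cons hacc).congr fun i => by
      rw [foldl_cons_eq, List.append_nil]

theorem append (hL : PolyComp N enc fun i => .ofList ((L i).map (ea i)))
    (hlen : PolyBdd N fun i => (L i).length)
    (hL' : PolyComp N enc fun i => .ofList ((L' i).map (ea i))) :
    PolyComp N enc fun i => .ofList ((L i ++ L' i).map (ea i)) :=
  (foldl (F := fun _ acc x => x :: acc) (b := L')
    (eb := fun i (l : List (α i)) => .ofList (l.map (ea i))) (hL.reverse hlen)
    (hlen.mono fun i => by simp) hL'
    fun _ _ _ _ _ _ _ _ hx hacc => hx.cons hacc).congr fun i => by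
      rw [foldl_cons_eq, List.reverse_reverse]

/-- As for folds, the body is only required on elements of the list; so is the bound on the number
of elements that it produces. -/
theorem flatMap {F : ∀ i, α i → List (β i)}
    (hL : PolyComp N enc fun i => .ofList ((L i).map (ea i)))
    (hlen : PolyBdd N fun i => (L i).length) {T : I → ℕ} (hT : PolyBdd N T)
    (hlen' : ∀ i, ∀ x ∈ L i, (F i x).length ≤ T i)
    (hF : ∀ (J : Type) (r : J → I) (enc' : J → Data) (x : ∀ j, α (r j)), (∀ j, x j ∈ L (r j)) →
      PolyComp (fun j => N (r j)) enc' (fun j => enc (r j)) →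
      PolyComp (fun j => N (r j)) enc' (fun j => ea (r j) (x j)) →
      PolyComp (fun j => N (r j)) enc' (fun j => .ofList ((F (r j) (x j)).map (eb (r j))))) :
    PolyComp N enc fun i => .ofList (((L i).flatMap (F i)).map (eb i)) :=
  (foldl (F := fun i acc x => F i x ++ acc) (b := fun _ => [])
    (eb := fun i (l : List (β i)) => .ofList (l.map (eb i))) (hL.reverse hlen)
    (hlen.mono fun i => by simp) list_nil
    fun J r enc' x acc hx _ he hvx hacc =>
      (hF J r enc' x (fun j => by simpa using hx j) he hvx).append
        ((hT.comp r).mono fun j => hlen' _ _ (by simpa using hx j)) hacc).congr fun i => by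
      rw [List.foldl_reverse]
      congr 2
      induction L i with
      | nil => rfl
      | cons x l ih => simp [ih]

theorem map {F : ∀ i, α i → β i}
    (hL : PolyComp N enc fun i => .ofList ((L i).map (ea i)))
    (hlen : PolyBdd N fun i => (L i).length)
    (hF : ∀ (J : Type) (r : J → I) (enc' : J → Data) (x : ∀ j, α (r j)), (∀ j, x j ∈ L (r j)) →
      PolyComp (fun j => N (r j)) enc' (fun j => enc (r j)) →
      PolyComp (fun j => N (r j)) enc' (fun j => ea (r j) (x j)) →
      PolyComp (fun j => N (r j)) enc' (fun j => eb (r j) (F (r j) (x j)))) :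
    PolyComp N enc fun i => .ofList (((L i).map (F i)).map (eb i)) :=
  (flatMap (F := fun i x => [F i x]) hL hlen (.const 1) (fun _ _ _ => le_rfl)
    fun J r enc' x hx he hvx => (hF J r enc' x hx he hvx).cons list_nil).congr fun i => by
      exact congrArg (fun l => Data.ofList (l.map (eb i))) (List.flatMap_pure_eq_map _ _)

theorem exists_mem {p : ∀ i, α i → Prop}
    (hL : PolyComp N enc fun i => .ofList ((L i).map (ea i)))
    (hlen : PolyBdd N fun i => (L i).length)
    (hp : ∀ (J : Type) (r : J → I) (enc' : J → Data) (x : ∀ j, α (r j)), (∀ j, x j ∈ L (r j)) →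
      PolyComp (fun j => N (r j)) enc' (fun j => enc (r j)) →
      PolyComp (fun j => N (r j)) enc' (fun j => ea (r j) (x j)) →
      PolyComp (fun j => N (r j)) enc' (fun j => .ofProp (p (r j) (x j)))) :
    PolyComp N enc fun i => .ofProp (∃ x ∈ L i, p i x) :=
  (foldl (F := fun i acc x => acc ∨ p i x) (b := fun _ => False)
    (eb := fun _ => .ofProp) hL hlen (nil.congr fun i => (Data.ofProp_of_not id).symm)
    fun J r enc' x acc hx _ he hvx hacc => hacc.or (hp J r enc' x hx he hvx)).congr_prop fun i => by
      have : ∀ (l : List (α i)) (b : Prop),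
          l.foldl (fun acc x => acc ∨ p i x) b ↔ b ∨ ∃ x ∈ l, p i x := by
        intro l
        induction l with
        | nil => simp
        | cons x l ih => intro b; rw [List.foldl_cons, ih]; simp [or_assoc]
      simp [this]

theorem forall_mem {p : ∀ i, α i → Prop}
    (hL : PolyComp N enc fun i => .ofList ((L i).map (ea i)))
    (hlen : PolyBdd N fun i => (L i).length)
    (hp : ∀ (J : Type) (r : J → I) (enc' : J → Data) (x : ∀ j, α (r j)), (∀ j, x j ∈ L (r j)) →
      PolyComp (fun j => N (r j)) enc' (fun j => enc (r j)) →
      PolyComp (fun j => N (r j)) enc' (fun j => ea (r j) (x j)) →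
      PolyComp (fun j => N (r j)) enc' (fun j => .ofProp (p (r j) (x j)))) :
    PolyComp N enc fun i => .ofProp (∀ x ∈ L i, p i x) :=
  (exists_mem (p := fun i x => ¬ p i x) hL hlen
    fun J r enc' x hx he hvx => (hp J r enc' x hx he hvx).not).not.congr_prop fun i => by simp

theorem lastSat {p : ∀ i, α i → Prop} {F : ∀ i, α i → β i} {d : ∀ i, β i}
    (hL : PolyComp N enc fun i => .ofList ((L i).map (ea i)))
    (hlen : PolyBdd N fun i => (L i).length)
    (hp : ∀ (J : Type) (r : J → I) (enc' : J → Data) (x : ∀ j, α (r j)), (∀ j, x j ∈ L (r j)) →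
      PolyComp (fun j => N (r j)) enc' (fun j => enc (r j)) →
      PolyComp (fun j => N (r j)) enc' (fun j => ea (r j) (x j)) →
      PolyComp (fun j => N (r j)) enc' (fun j => .ofProp (p (r j) (x j))))
    (hF : ∀ (J : Type) (r : J → I) (enc' : J → Data) (x : ∀ j, α (r j)), (∀ j, x j ∈ L (r j)) →
      PolyComp (fun j => N (r j)) enc' (fun j => enc (r j)) →
      PolyComp (fun j => N (r j)) enc' (fun j => ea (r j) (x j)) →
      PolyComp (fun j => N (r j)) enc' (fun j => eb (r j) (F (r j) (x j))))
    (hd : PolyComp N enc fun i => eb i (d i)) :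
    PolyComp N enc fun i => eb i ((L i).lastSat (p i) (F i) (d i)) :=
  foldl (F := fun i acc x => open Classical in if p i x then F i x else acc) hL hlen hd
    fun J r enc' x acc hx _ he hvx hacc =>
      ((hp J r enc' x hx he hvx).ite (hF J r enc' x hx he hvx) hacc).congr fun j => by
        split_ifs <;> rfl

theorem length (hL : PolyComp N enc fun i => .ofList ((L i).map (ea i)))
    (hlen : PolyBdd N fun i => (L i).length) :
    PolyComp N enc fun i => .ofNat (L i).length :=
  (hL.map (F := fun _ _ => ()) (eb := fun _ _ => .nil) hlen
    fun _ _ _ _ _ _ _ => nil).congr fun i => by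
      simp [Data.ofNat_eq_ofList]

theorem powList (hL : PolyComp N enc fun i => .ofList ((L i).map (ea i)))
    (hlen : PolyBdd N fun i => 2 ^ (L i).length) :
    PolyComp N enc fun i => .ofList ((L i).powList.map fun X => .ofList (X.map (ea i))) :=
  foldl (F := fun _ acc x => acc ++ acc.map (List.cons x)) (b := fun _ => [[]])
    (eb := fun i (l : List (List (α i))) => .ofList (l.map fun X => .ofList (X.map (ea i)))) hL
    (hlen.mono fun i => Nat.lt_two_pow_self.le) (list_nil.cons list_nil)
    fun J r enc' x acc hx hp he hvx hacc => by
      have hb : PolyBdd (fun j => N (r j)) fun j => (acc j).length := by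
        refine (hlen.comp r).mono fun j => ?_
        obtain ⟨L₁, h1, h2⟩ := hp j
        rw [h2]
        exact (List.length_powList L₁).trans_le (Nat.pow_le_pow_right (by omega) h1.length_le)
      exact hacc.append hb (hacc.map hb fun K r' enc'' X _ he' hX => (hvx.lift he').cons hX)

end Lists

/-! ### Natural numbers and tables -/

theorem zero : PolyComp N enc fun _ => .ofNat 0 := nil

theorem iterate_right {k : I → ℕ} (hk : PolyComp N enc fun i => .ofNat (k i)) (hb : PolyBdd N k)
    (hf : PolyComp N enc f) : PolyComp N enc fun i => Data.right^[k i] (f i) :=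
  (foldl (α := fun _ => Unit) (β := fun _ => Data) (F := fun _ acc _ => acc.right)
    (L := fun i => List.replicate (k i) ()) (ea := fun _ _ => .nil) (eb := fun _ => _root_.id)
    (hk.congr fun i => Data.ofNat_eq_ofList _) (hb.mono fun i => by simp) hf
    fun _ _ _ _ _ _ _ _ _ hacc => hacc.right).congr fun i => by
      have : ∀ (k : ℕ) (x : Data),
          (List.replicate k ()).foldl (fun acc _ => acc.right) x = Data.right^[k] x := by
        intro k
        induction k with
        | zero => exact fun _ => rfl
        | succ k ih => exact fun x => ih x.right
      exact this _ _

theorem sub {k l : I → ℕ} (hk : PolyComp N enc fun i => .ofNat (k i))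
    (hl : PolyComp N enc fun i => .ofNat (l i)) (hb : PolyBdd N l) :
    PolyComp N enc fun i => .ofNat (k i - l i) :=
  (hl.iterate_right hb hk).congr fun _ => Data.right_ofNat _ _

theorem nat_le {k l : I → ℕ} (hk : PolyComp N enc fun i => .ofNat (k i))
    (hl : PolyComp N enc fun i => .ofNat (l i)) (hb : PolyBdd N l) :
    PolyComp N enc fun i => .ofProp (k i ≤ l i) :=
  (hk.sub hl hb).ne_nil.not.congr_prop fun i => by
    cases h : k i - l i with
    | zero => simp [Data.ofNat]; omega
    | succ n => simp [Data.ofNat]; omega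

theorem nat_eq {k l : I → ℕ} (hk : PolyComp N enc fun i => .ofNat (k i))
    (hl : PolyComp N enc fun i => .ofNat (l i)) (hb : PolyBdd N k) (hb' : PolyBdd N l) :
    PolyComp N enc fun i => .ofProp (k i = l i) :=
  ((hk.nat_le hl hb').and (hl.nat_le hk hb)).congr_prop fun i => by omega

section Fin

variable {n : I → ℕ}

/-- Table lookup. -/
theorem get {F : ∀ i, Fin (n i) → Data} {s : ∀ i, Fin (n i)}
    (hF : PolyComp N enc fun i => .table (F i)) (hs : PolyComp N enc fun i => .ofNat (s i : ℕ))
    (hn : PolyBdd N n) : PolyComp N enc fun i => F i (s i) :=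
  (hs.iterate_right (hn.mono fun i => (s i).2.le) hF).left.congr fun _ =>
    Data.left_right_table _ _

theorem finRange (hn : PolyComp N enc fun i => .ofNat (n i)) (hb : PolyBdd N n) :
    PolyComp N enc fun i => .ofList ((List.finRange (n i)).map fun s : Fin (n i) => .ofNat (s : ℕ)) := by
  -- the list `[k - 1, …, 0]` is extended by its own length
  have key : ∀ k : ℕ, (List.replicate k ()).foldl (fun acc _ => acc.length :: acc) [] =
      (List.range k).reverse := by
    intro k
    induction k with
    | zero => rfl
    | succ k ih =>
      rw [List.replicate_succ', List.foldl_append, ih, List.range_succ]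
      simp
  refine PolyComp.congr (reverse (α := fun _ => ℕ) (ea := fun _ => .ofNat)
    (foldl (α := fun _ => Unit) (β := fun _ => List ℕ) (F := fun _ acc _ => acc.length :: acc)
      (L := fun i => List.replicate (n i) ()) (ea := fun _ _ => .nil)
      (eb := fun _ l => .ofList (l.map .ofNat)) (b := fun _ => [])
      (hn.congr fun i => Data.ofNat_eq_ofList _) (hb.mono fun i => by simp) list_nil
      fun J r enc' x acc hx hp he hvx hacc =>
        (hacc.length ((hb.comp r).mono fun j => ?_)).cons hacc)
    (hb.mono fun i => ?_)) fun i => ?_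
  · obtain ⟨L₁, h1, h2⟩ := hp j
    rw [h2, (List.eq_replicate_length (l := L₁) (a := ())).2 fun _ _ => rfl, key]
    simpa using h1.length_le
  · simp [key]
  · rw [key, List.reverse_reverse, ← List.map_coe_finRange_eq_range, List.map_map]
    rfl

theorem exists_fin {p : ∀ i, Fin (n i) → Prop} (hn : PolyComp N enc fun i => .ofNat (n i))
    (hb : PolyBdd N n)
    (hp : ∀ (J : Type) (r : J → I) (enc' : J → Data) (x : ∀ j, Fin (n (r j))),
      PolyComp (fun j => N (r j)) enc' (fun j => enc (r j)) →
      PolyComp (fun j => N (r j)) enc' (fun j => .ofNat (x j : ℕ)) →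
      PolyComp (fun j => N (r j)) enc' (fun j => .ofProp (p (r j) (x j)))) :
    PolyComp N enc fun i => .ofProp (∃ s, p i s) :=
  ((hn.finRange hb).exists_mem (hb.mono fun i => by simp)
    fun J r enc' x _ => hp J r enc' x).congr_prop fun i => by simp

theorem forall_fin {p : ∀ i, Fin (n i) → Prop} (hn : PolyComp N enc fun i => .ofNat (n i))
    (hb : PolyBdd N n)
    (hp : ∀ (J : Type) (r : J → I) (enc' : J → Data) (x : ∀ j, Fin (n (r j))),
      PolyComp (fun j => N (r j)) enc' (fun j => enc (r j)) →
      PolyComp (fun j => N (r j)) enc' (fun j => .ofNat (x j : ℕ)) →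
      PolyComp (fun j => N (r j)) enc' (fun j => .ofProp (p (r j) (x j)))) :
    PolyComp N enc fun i => .ofProp (∀ s, p i s) :=
  ((hn.finRange hb).forall_mem (hb.mono fun i => by simp)
    fun J r enc' x _ => hp J r enc' x).congr_prop fun i => by simp

theorem table {F : ∀ i, Fin (n i) → Data} (hn : PolyComp N enc fun i => .ofNat (n i))
    (hb : PolyBdd N n)
    (hF : ∀ (J : Type) (r : J → I) (enc' : J → Data) (x : ∀ j, Fin (n (r j))),
      PolyComp (fun j => N (r j)) enc' (fun j => enc (r j)) →
      PolyComp (fun j => N (r j)) enc' (fun j => .ofNat (x j : ℕ)) →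
      PolyComp (fun j => N (r j)) enc' (fun j => F (r j) (x j))) :
    PolyComp N enc fun i => .table (F i) :=
  ((hn.finRange hb).map (eb := fun _ => _root_.id) (hb.mono fun i => by simp)
    fun J r enc' x _ => hF J r enc' x).congr fun i => by
      rw [Data.table_eq_ofList, List.map_id]

end Fin

end PolyComp

/-! ### The attractor of the reachability game on families of beliefs -/

/-- A memory state of the strategy under construction: its number, a position of the reachability
game (a state of the automaton and a family of beliefs of Adam, each of which Eve must defeat), the
action that Eve plays there and the number of the next memory state for each state that may be
observed next. -/
structure Entry (n m : ℕ) where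
  idx : ℕ
  q : Fin m
  fam : List (List (Fin n))
  act : ℕ
  succ : Fin n → ℕ

/-- All families of sets of states, as lists of lists. -/
def families (n : ℕ) : List (List (List (Fin n))) := (List.finRange n).powList.powList

section Algorithm

variable {n a b m : ℕ} (A : Arena (Fin n) (Fin a) (Fin b))
  (T : ActionAutomaton A.simE (Fin a) (Fin m)) (K F : Set (Fin n))

/-- If Adam has belief `B` and Eve plays `e`, then either `F` may be reached already, or for every
action of Adam some belief that he may have after the next observation belongs to `fam'`. -/
def Secured (e : Fin a) (fam' : List (List (Fin n))) (B : List (Fin n)) : Prop :=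
  (∃ s ∈ B, s ∈ F) ∨ ∀ c, ∃ s', (∃ r ∈ B, A.δ r e c s' ≠ 0) ∧
    ∃ X ∈ fam', ∀ s, s ∈ X ↔ A.simA s' s ∧ ∃ r ∈ B, A.δ r e c s ≠ 0

/-- The position of `w` has automaton state `q`, and its family contains all members of `fam` that
are compatible with Eve's observation of `s`. -/
def Covers (q : Fin m) (s : Fin n) (fam : List (List (Fin n))) (w : Entry n m) : Prop :=
  w.q = q ∧ ∀ X ∈ fam, (∃ t ∈ X, A.simE s t) → ∃ Y ∈ w.fam, ∀ t, t ∈ X ↔ t ∈ Y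

/-- From position `(q, fam)` Eve can, by playing `e`, reduce all obligations in `fam` to
obligations in `fam'`, and whatever she observes, a position in `W` covers these. -/
def CanMove (W : List (Entry n m)) (q : Fin m) (fam : List (List (Fin n))) (e : Fin a)
    (fam' : List (List (Fin n))) : Prop :=
  e ∈ T.Act q ∧ (∀ B ∈ fam, Secured A F e fam' B) ∧
    ∀ s, ∃ w ∈ W, Covers A (T.next q (e, Quotient.mk A.simE s)) s fam' w

/-- The memory state for an automaton state without any obligations left: it is only necessary
to keep playing allowed actions. -/
def baseEntry (q : Fin m) : Entry n m :=
  (List.finRange a).lastSat (fun e => e ∈ T.Act q)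
    (fun e => ⟨q, q, [], e, fun s => (T.next q (e, Quotient.mk A.simE s) : ℕ)⟩)
    ⟨q, q, [], 0, fun _ => 0⟩

/-- The number of an entry of `W` that covers `fam`. -/
def coverIdx (W : List (Entry n m)) (q : Fin m) (fam : List (List (Fin n))) (s : Fin n) : ℕ :=
  W.lastSat (Covers A q s fam) Entry.idx 0

/-- The memory state in which Eve plays `e` at `(q, fam)` and goes on with obligations `fam'`. -/
def moveEntry (W : List (Entry n m)) (q : Fin m) (fam : List (List (Fin n))) (e : Fin a)
    (fam' : List (List (Fin n))) : Entry n m :=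
  ⟨W.length, q, fam, e, fun s => coverIdx A W (T.next q (e, Quotient.mk A.simE s)) fam' s⟩

/-- Adds the position `p` to `W` if Eve can move from it into `W`. -/
def attrStep (W : List (Entry n m)) (p : Fin m × List (List (Fin n))) : List (Entry n m) :=
  (List.finRange a).lastSat (fun e => ∃ fam' ∈ families n, CanMove A T F W p.1 p.2 e fam')
    (fun e => (families n).lastSat (CanMove A T F W p.1 p.2 e)
      (fun fam' => W ++ [moveEntry A T W p.1 p.2 e fam']) W) W

/-- All positions of the game. -/
def positions (n m : ℕ) : List (Fin m × List (List (Fin n))) :=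
  (List.finRange m).flatMap fun q => (families n).map fun fam => (q, fam)

/-- The attractor: every position is processed as often as there are positions. A position may
be added several times. -/
def attractor : List (Entry n m) :=
  ((positions n m).flatMap fun _ => positions n m).foldl (attrStep A T F)
    ((List.finRange m).map (baseEntry A T))

open Classical in
/-- The initial beliefs: Adam knows the initial state. -/
def initFam : List (List (Fin n)) :=
  (List.finRange n).flatMap fun s => if s ∈ K then [[s]] else []

/-- The attractor together with an initial memory state, which has not yet read an observation. -/
def memoryEntries : List (Entry n m) :=
  attractor A T F ++ [⟨(attractor A T F).length, T.init, [], 0,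
    coverIdx A (attractor A T F) T.init (initFam K)⟩]

/-- The criterion for the existence of a strategy that is evaluated by the decision procedure. -/
def Solvable : Prop :=
  0 < a ∧ ∀ s, ∃ w ∈ attractor A T F, Covers A T.init s (initFam K) w

end Algorithm

section Bounds

variable {n a b m : ℕ} {A : Arena (Fin n) (Fin a) (Fin b)}
  {T : ActionAutomaton A.simE (Fin a) (Fin m)} {K F : Set (Fin n)}

theorem length_families (n : ℕ) : (families n).length = 2 ^ 2 ^ n := by
  simp [families, List.length_powList]

/-- The size bounds on families that make it possible to search them in polynomial time. -/
def SmallFam {n : ℕ} (fam : List (List (Fin n))) : Prop :=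
  fam.length ≤ 2 ^ n ∧ ∀ X ∈ fam, X.length ≤ n

theorem smallFam_of_mem_families {fam : List (List (Fin n))} (h : fam ∈ families n) :
    SmallFam fam := by
  refine ⟨by simpa [List.length_powList] using List.mem_powList_length h, fun X hX => ?_⟩
  simpa using List.mem_powList_length (List.mem_powList_subset h hX)

theorem smallFam_initFam : SmallFam (initFam K) := by
  classical
  constructor
  · refine le_trans ?_ (Nat.lt_two_pow_self (n := n)).le
    rw [initFam, List.length_flatMap]
    refine (List.sum_le_card_nsmul _ 1 ?_).trans (by simp)
    simp only [List.mem_map, forall_exists_index, and_imp]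
    rintro _ s - rfl
    split_ifs <;> simp
  · intro X hX
    obtain ⟨s, -, hs⟩ := List.mem_flatMap.1 hX
    split_ifs at hs
    · obtain rfl : X = [s] := by simpa using hs
      exact Nat.succ_le_of_lt s.pos
    · simp at hs

theorem length_positions (n m : ℕ) : (positions n m).length = m * 2 ^ 2 ^ n := by
  simp [positions, length_families]

theorem attrStep_cases (W : List (Entry n m)) (p : Fin m × List (List (Fin n))) :
    (∃ e, ∃ fam' ∈ families n, CanMove A T F W p.1 p.2 e fam' ∧
      attrStep A T F W p = W ++ [moveEntry A T W p.1 p.2 e fam']) ∨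
    ((¬ ∃ e, ∃ fam' ∈ families n, CanMove A T F W p.1 p.2 e fam') ∧ attrStep A T F W p = W) := by
  obtain ⟨e, -, he, h⟩ | ⟨h, h'⟩ := List.lastSat_cases (d := W)
    (p := fun e => ∃ fam' ∈ families n, CanMove A T F W p.1 p.2 e fam')
    (f := fun e => (families n).lastSat (CanMove A T F W p.1 p.2 e)
      (fun fam' => W ++ [moveEntry A T W p.1 p.2 e fam']) W) (List.finRange a)
  · obtain ⟨fam', hf, hm, h'⟩ := List.exists_lastSat_eq (d := W)
      (f := fun fam' => W ++ [moveEntry A T W p.1 p.2 e fam']) he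
    exact .inl ⟨e, fam', hf, hm, h.trans h'⟩
  · exact .inr ⟨fun ⟨e, he⟩ => h e (List.mem_finRange e) he, h'⟩

theorem length_foldl_attrStep (l : List (Fin m × List (List (Fin n)))) (W : List (Entry n m)) :
    (l.foldl (attrStep A T F) W).length ≤ W.length + l.length := by
  induction l generalizing W with
  | nil => simp
  | cons p l ih =>
    refine (ih _).trans ?_
    obtain ⟨e, f, -, -, h⟩ | ⟨-, h⟩ := attrStep_cases (A := A) (T := T) (F := F) W p
    · simp [h]; try omega
    · simp [h]; try omega

theorem length_attractor :
    (attractor A T F).length ≤ m + (m * 2 ^ 2 ^ n) * (m * 2 ^ 2 ^ n) := by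
  refine (length_foldl_attrStep _ _).trans ?_
  simp [length_positions]

end Bounds

/-! ### The attractor is computable in polynomial time -/

/-- An input of the decision problem, together with the code for probabilities. -/
structure Inst where
  code : ℝ≥0∞ → Data
  code_eq_nil : ∀ p, code p = Data.nil ↔ p = 0
  n : ℕ
  a : ℕ
  b : ℕ
  m : ℕ
  A : Arena (Fin n) (Fin a) (Fin b)
  T : ActionAutomaton A.simE (Fin a) (Fin m)
  K : Set (Fin n)
  F : Set (Fin n)

namespace Inst

/-- The quantity in which the running time is polynomial. -/
def size (g : Inst) : ℕ := 2 ^ 2 ^ g.n + g.m + g.a + g.b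

/-- The encoding of the input. -/
def enc (g : Inst) : Data := encodeGame g.code g.A g.T g.K g.F

theorem n_le_size (g : Inst) : g.n ≤ g.size := by
  have h1 := Nat.lt_two_pow_self (n := g.n)
  have h2 := Nat.lt_two_pow_self (n := 2 ^ g.n)
  unfold size
  omega

theorem two_pow_le_size (g : Inst) : 2 ^ g.n ≤ g.size := by
  have h2 := Nat.lt_two_pow_self (n := 2 ^ g.n)
  unfold size
  omega

end Inst

/-- Sets of states as data. -/
def encSet {n : ℕ} (X : List (Fin n)) : Data := .ofList (X.map fun s : Fin n => .ofNat (s : ℕ))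

/-- Families as data. -/
def encFam {n : ℕ} (fam : List (List (Fin n))) : Data := .ofList (fam.map encSet)

/-- Entries as data. -/
def Entry.enc {n m : ℕ} (w : Entry n m) : Data :=
  .node (.ofNat w.idx) (.node (.ofNat (w.q : ℕ)) (.node (encFam w.fam)
    (.node (.ofNat w.act) (.table fun s => .ofNat (w.succ s)))))

section PolyTime

open PolyComp

variable {I : Type} {enc : I → Data} {g : I → Inst}

theorem polyBdd_n : PolyBdd (fun i => (g i).size) fun i => (g i).n :=
  PolyBdd.self.mono fun i => (g i).n_le_size

theorem polyBdd_m : PolyBdd (fun i => (g i).size) fun i => (g i).m :=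
  PolyBdd.self.mono fun i => by
    have := Nat.zero_le (2 ^ 2 ^ (g i).n)
    unfold Inst.size; omega

theorem polyBdd_a : PolyBdd (fun i => (g i).size) fun i => (g i).a :=
  PolyBdd.self.mono fun i => by
    have := Nat.zero_le (2 ^ 2 ^ (g i).n)
    unfold Inst.size; omega

theorem polyBdd_b : PolyBdd (fun i => (g i).size) fun i => (g i).b :=
  PolyBdd.self.mono fun i => by
    have := Nat.zero_le (2 ^ 2 ^ (g i).n)
    unfold Inst.size; omega

theorem polyBdd_length_families :
    PolyBdd (fun i => (g i).size) fun i => (families (g i).n).length :=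
  PolyBdd.self.mono fun i => by rw [length_families]; unfold Inst.size; omega

theorem polyBdd_fam {fam : ∀ i, List (List (Fin (g i).n))} (h : ∀ i, SmallFam (fam i)) :
    PolyBdd (fun i => (g i).size) fun i => (fam i).length :=
  PolyBdd.self.mono fun i => (h i).1.trans (g i).two_pow_le_size

theorem polyBdd_length_positions :
    PolyBdd (fun i => (g i).size) fun i => (positions (g i).n (g i).m).length :=
  (polyBdd_m.mul polyBdd_length_families).mono fun i => by rw [length_positions, length_families]

theorem polyComp_n (hg : PolyComp (fun i => (g i).size) enc fun i => (g i).enc) :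
    PolyComp (fun i => (g i).size) enc fun i => .ofNat (g i).n := hg.left

theorem polyComp_a (hg : PolyComp (fun i => (g i).size) enc fun i => (g i).enc) :
    PolyComp (fun i => (g i).size) enc fun i => .ofNat (g i).a := hg.right.left

theorem polyComp_b (hg : PolyComp (fun i => (g i).size) enc fun i => (g i).enc) :
    PolyComp (fun i => (g i).size) enc fun i => .ofNat (g i).b := hg.right.right.left

theorem polyComp_m (hg : PolyComp (fun i => (g i).size) enc fun i => (g i).enc) :
    PolyComp (fun i => (g i).size) enc fun i => .ofNat (g i).m := hg.right.right.right.left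

theorem polyComp_delta (hg : PolyComp (fun i => (g i).size) enc fun i => (g i).enc)
    {s s' : ∀ i, Fin (g i).n} {e : ∀ i, Fin (g i).a} {c : ∀ i, Fin (g i).b}
    (hs : PolyComp (fun i => (g i).size) enc fun i => .ofNat (s i : ℕ))
    (he : PolyComp (fun i => (g i).size) enc fun i => .ofNat (e i : ℕ))
    (hc : PolyComp (fun i => (g i).size) enc fun i => .ofNat (c i : ℕ))
    (hs' : PolyComp (fun i => (g i).size) enc fun i => .ofNat (s' i : ℕ)) :
    PolyComp (fun i => (g i).size) enc fun i => .ofProp ((g i).A.δ (s i) (e i) (c i) (s' i) ≠ 0) := by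
  have h : PolyComp (fun i => (g i).size) enc fun i => .table fun s => .table fun e =>
      .table fun c => .table fun s' => (g i).code ((g i).A.δ s e c s') :=
    hg.right.right.right.right.left
  exact ((((h.get hs polyBdd_n).get he polyBdd_a).get hc polyBdd_b).get hs' polyBdd_n).ne_nil
    |>.congr_prop fun i => ((g i).code_eq_nil _).not

theorem polyComp_simE (hg : PolyComp (fun i => (g i).size) enc fun i => (g i).enc)
    {s s' : ∀ i, Fin (g i).n}
    (hs : PolyComp (fun i => (g i).size) enc fun i => .ofNat (s i : ℕ))
    (hs' : PolyComp (fun i => (g i).size) enc fun i => .ofNat (s' i : ℕ)) :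
    PolyComp (fun i => (g i).size) enc fun i => .ofProp ((g i).A.simE (s i) (s' i)) := by
  have h : PolyComp (fun i => (g i).size) enc fun i => .table fun s => .table fun s' =>
      .ofProp ((g i).A.simE s s') := hg.right.right.right.right.right.left
  exact (h.get hs polyBdd_n).get hs' polyBdd_n

theorem polyComp_simA (hg : PolyComp (fun i => (g i).size) enc fun i => (g i).enc)
    {s s' : ∀ i, Fin (g i).n}
    (hs : PolyComp (fun i => (g i).size) enc fun i => .ofNat (s i : ℕ))
    (hs' : PolyComp (fun i => (g i).size) enc fun i => .ofNat (s' i : ℕ)) :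
    PolyComp (fun i => (g i).size) enc fun i => .ofProp ((g i).A.simA (s i) (s' i)) := by
  have h : PolyComp (fun i => (g i).size) enc fun i => .table fun s => .table fun s' =>
      .ofProp ((g i).A.simA s s') := hg.right.right.right.right.right.right.left
  exact (h.get hs polyBdd_n).get hs' polyBdd_n

theorem polyComp_mem_K (hg : PolyComp (fun i => (g i).size) enc fun i => (g i).enc)
    {s : ∀ i, Fin (g i).n}
    (hs : PolyComp (fun i => (g i).size) enc fun i => .ofNat (s i : ℕ)) :
    PolyComp (fun i => (g i).size) enc fun i => .ofProp (s i ∈ (g i).K) := by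
  have h : PolyComp (fun i => (g i).size) enc fun i => .table fun s => .ofProp (s ∈ (g i).K) :=
    hg.right.right.right.right.right.right.right.left
  exact h.get hs polyBdd_n

theorem polyComp_mem_F (hg : PolyComp (fun i => (g i).size) enc fun i => (g i).enc)
    {s : ∀ i, Fin (g i).n}
    (hs : PolyComp (fun i => (g i).size) enc fun i => .ofNat (s i : ℕ)) :
    PolyComp (fun i => (g i).size) enc fun i => .ofProp (s i ∈ (g i).F) := by
  have h : PolyComp (fun i => (g i).size) enc fun i => .table fun s => .ofProp (s ∈ (g i).F) :=
    hg.right.right.right.right.right.right.right.right.left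
  exact h.get hs polyBdd_n

theorem polyComp_init (hg : PolyComp (fun i => (g i).size) enc fun i => (g i).enc) :
    PolyComp (fun i => (g i).size) enc fun i => .ofNat ((g i).T.init : ℕ) :=
  hg.right.right.right.right.right.right.right.right.right.left

theorem polyComp_next (hg : PolyComp (fun i => (g i).size) enc fun i => (g i).enc)
    {q : ∀ i, Fin (g i).m} {e : ∀ i, Fin (g i).a} {s : ∀ i, Fin (g i).n}
    (hq : PolyComp (fun i => (g i).size) enc fun i => .ofNat (q i : ℕ))
    (he : PolyComp (fun i => (g i).size) enc fun i => .ofNat (e i : ℕ))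
    (hs : PolyComp (fun i => (g i).size) enc fun i => .ofNat (s i : ℕ)) :
    PolyComp (fun i => (g i).size) enc fun i =>
      .ofNat ((g i).T.next (q i) (e i, Quotient.mk (g i).A.simE (s i)) : ℕ) := by
  have h : PolyComp (fun i => (g i).size) enc fun i => .table fun q => .table fun e =>
      .table fun s => .ofNat ((g i).T.next q (e, Quotient.mk (g i).A.simE s) : ℕ) :=
    hg.right.right.right.right.right.right.right.right.right.right.right.left
  exact ((h.get hq polyBdd_m).get he polyBdd_a).get hs polyBdd_n

theorem polyComp_mem_Act (hg : PolyComp (fun i => (g i).size) enc fun i => (g i).enc)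
    {q : ∀ i, Fin (g i).m} {e : ∀ i, Fin (g i).a}
    (hq : PolyComp (fun i => (g i).size) enc fun i => .ofNat (q i : ℕ))
    (he : PolyComp (fun i => (g i).size) enc fun i => .ofNat (e i : ℕ)) :
    PolyComp (fun i => (g i).size) enc fun i => .ofProp (e i ∈ (g i).T.Act (q i)) := by
  have h : PolyComp (fun i => (g i).size) enc fun i => .table fun q => .table fun e =>
      .ofProp (e ∈ (g i).T.Act q) :=
    hg.right.right.right.right.right.right.right.right.right.right.right.right.left
  exact (h.get hq polyBdd_m).get he polyBdd_a

theorem polyComp_mem_set {s : ∀ i, Fin (g i).n} {X : ∀ i, List (Fin (g i).n)}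
    (hs : PolyComp (fun i => (g i).size) enc fun i => .ofNat (s i : ℕ))
    (hX : PolyComp (fun i => (g i).size) enc fun i => encSet (X i))
    (hb : ∀ i, (X i).length ≤ (g i).n) :
    PolyComp (fun i => (g i).size) enc fun i => .ofProp (s i ∈ X i) :=
  (exists_mem (α := fun i => Fin (g i).n) (p := fun i x => (s i : ℕ) = (x : ℕ))
    (ea := fun _ x => .ofNat (x : ℕ)) hX (polyBdd_n.mono hb)
    fun J r enc' x _ up hx => (hs.lift up).nat_eq hx
      ((polyBdd_n.comp r).mono fun j => (s (r j)).2.le)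
      ((polyBdd_n.comp r).mono fun j => (x j).2.le)).congr_prop fun i => by
    simp [← Fin.ext_iff]

/-- Whether `s` is a possible successor of some state of the belief `B`. -/
theorem polyComp_post (hg : PolyComp (fun i => (g i).size) enc fun i => (g i).enc)
    {s : ∀ i, Fin (g i).n} {B : ∀ i, List (Fin (g i).n)} {e : ∀ i, Fin (g i).a}
    {c : ∀ i, Fin (g i).b}
    (hB : PolyComp (fun i => (g i).size) enc fun i => encSet (B i))
    (hb : ∀ i, (B i).length ≤ (g i).n)
    (he : PolyComp (fun i => (g i).size) enc fun i => .ofNat (e i : ℕ))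
    (hc : PolyComp (fun i => (g i).size) enc fun i => .ofNat (c i : ℕ))
    (hs : PolyComp (fun i => (g i).size) enc fun i => .ofNat (s i : ℕ)) :
    PolyComp (fun i => (g i).size) enc fun i =>
      .ofProp (∃ r ∈ B i, (g i).A.δ r (e i) (c i) (s i) ≠ 0) :=
  exists_mem hB (polyBdd_n.mono hb) fun _ _ _ _ _ up hx =>
    polyComp_delta (hg.lift up) hx (he.lift up) (hc.lift up) (hs.lift up)

theorem polyComp_secured (hg : PolyComp (fun i => (g i).size) enc fun i => (g i).enc)
    {B : ∀ i, List (Fin (g i).n)} {e : ∀ i, Fin (g i).a} {fam : ∀ i, List (List (Fin (g i).n))}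
    (he : PolyComp (fun i => (g i).size) enc fun i => .ofNat (e i : ℕ))
    (hfam : PolyComp (fun i => (g i).size) enc fun i => encFam (fam i))
    (hsmall : ∀ i, SmallFam (fam i))
    (hB : PolyComp (fun i => (g i).size) enc fun i => encSet (B i))
    (hb : ∀ i, (B i).length ≤ (g i).n) :
    PolyComp (fun i => (g i).size) enc fun i =>
      .ofProp (Secured (g i).A (g i).F (e i) (fam i) (B i)) := by
  refine (exists_mem hB (polyBdd_n.mono hb) fun _ _ _ _ _ up hx =>
    polyComp_mem_F (hg.lift up) hx).or ?_
  refine forall_fin (polyComp_b hg) polyBdd_b fun J₁ r₁ enc₁ c up₁ hc => ?_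
  refine exists_fin (polyComp_n (hg.lift up₁)) (polyBdd_n.comp r₁)
    fun J₂ r₂ enc₂ s' up₂ hs' => ?_
  refine (polyComp_post ((hg.lift up₁).lift up₂) ((hB.lift up₁).lift up₂) (fun _ => hb _)
    ((he.lift up₁).lift up₂) (hc.lift up₂) hs').and ?_
  refine exists_mem ((hfam.lift up₁).lift up₂)
    (((polyBdd_fam hsmall).comp r₁).comp r₂) fun J₃ r₃ enc₃ X hX up₃ hX' => ?_
  have hg₃ := ((hg.lift up₁).lift up₂).lift up₃
  refine forall_fin (polyComp_n hg₃) polyBdd_n fun J₄ r₄ enc₄ s up₄ hs => ?_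
  refine (polyComp_mem_set hs (hX'.lift up₄) fun j => (hsmall _).2 _ (hX _)).iff ?_
  refine (polyComp_simA (hg₃.lift up₄) ((hs'.lift up₃).lift up₄) hs).and ?_
  exact polyComp_post (hg₃.lift up₄) ((((hB.lift up₁).lift up₂).lift up₃).lift up₄)
    (fun _ => hb _) ((((he.lift up₁).lift up₂).lift up₃).lift up₄)
    (((hc.lift up₂).lift up₃).lift up₄) hs

theorem polyComp_covers (hg : PolyComp (fun i => (g i).size) enc fun i => (g i).enc)
    {q : ∀ i, Fin (g i).m} {s : ∀ i, Fin (g i).n} {fam : ∀ i, List (List (Fin (g i).n))}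
    {w : ∀ i, Entry (g i).n (g i).m}
    (hq : PolyComp (fun i => (g i).size) enc fun i => .ofNat (q i : ℕ))
    (hs : PolyComp (fun i => (g i).size) enc fun i => .ofNat (s i : ℕ))
    (hfam : PolyComp (fun i => (g i).size) enc fun i => encFam (fam i))
    (hsmall : ∀ i, SmallFam (fam i))
    (hw : PolyComp (fun i => (g i).size) enc fun i => (w i).enc)
    (hwsmall : ∀ i, SmallFam (w i).fam) :
    PolyComp (fun i => (g i).size) enc fun i =>
      .ofProp (Covers (g i).A (q i) (s i) (fam i) (w i)) := by
  have hwq : PolyComp (fun i => (g i).size) enc fun i => .ofNat ((w i).q : ℕ) := hw.right.left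
  have hwfam : PolyComp (fun i => (g i).size) enc fun i => encFam (w i).fam := hw.right.right.left
  refine ((hwq.nat_eq hq (polyBdd_m.mono fun i => (w i).q.2.le)
    (polyBdd_m.mono fun i => (q i).2.le)).congr_prop fun i => by
      rw [← Fin.ext_iff]).and ?_
  refine forall_mem hfam (polyBdd_fam hsmall) fun J₁ r₁ enc₁ X hX up₁ hX' => ?_
  refine (exists_mem hX' (polyBdd_n.mono fun i => (hsmall _).2 _ (hX _))
    fun J₂ r₂ enc₂ t _ up₂ ht =>
      polyComp_simE ((hg.lift up₁).lift up₂) ((hs.lift up₁).lift up₂) ht).imp ?_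
  refine exists_mem (hwfam.lift up₁) ((polyBdd_fam hwsmall).comp r₁)
    fun J₂ r₂ enc₂ Y hY up₂ hY' => ?_
  refine forall_fin (polyComp_n ((hg.lift up₁).lift up₂)) polyBdd_n
    fun J₃ r₃ enc₃ t up₃ ht => ?_
  exact (polyComp_mem_set ht ((hX'.lift up₂).lift up₃) fun j => (hsmall _).2 _ (hX _)).iff
    (polyComp_mem_set ht (hY'.lift up₃) fun j => (hwsmall _).2 _ (hY _))

theorem polyComp_canMove (hg : PolyComp (fun i => (g i).size) enc fun i => (g i).enc)
    {W : ∀ i, List (Entry (g i).n (g i).m)} {q : ∀ i, Fin (g i).m} {e : ∀ i, Fin (g i).a}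
    {fam fam' : ∀ i, List (List (Fin (g i).n))}
    (hW : PolyComp (fun i => (g i).size) enc fun i => .ofList ((W i).map Entry.enc))
    (hWb : PolyBdd (fun i => (g i).size) fun i => (W i).length)
    (hWsmall : ∀ i, ∀ w ∈ W i, SmallFam w.fam)
    (hq : PolyComp (fun i => (g i).size) enc fun i => .ofNat (q i : ℕ))
    (hfam : PolyComp (fun i => (g i).size) enc fun i => encFam (fam i))
    (hsmall : ∀ i, SmallFam (fam i))
    (he : PolyComp (fun i => (g i).size) enc fun i => .ofNat (e i : ℕ))
    (hfam' : PolyComp (fun i => (g i).size) enc fun i => encFam (fam' i))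
    (hsmall' : ∀ i, SmallFam (fam' i)) :
    PolyComp (fun i => (g i).size) enc fun i =>
      .ofProp (CanMove (g i).A (g i).T (g i).F (W i) (q i) (fam i) (e i) (fam' i)) := by
  refine (polyComp_mem_Act hg hq he).and (PolyComp.and ?_ ?_)
  · exact forall_mem hfam (polyBdd_fam hsmall) fun J₁ r₁ enc₁ B hB up₁ hB' =>
      polyComp_secured (hg.lift up₁) (he.lift up₁) (hfam'.lift up₁) (fun _ => hsmall' _) hB'
        fun _ => (hsmall _).2 _ (hB _)
  · refine forall_fin (polyComp_n hg) polyBdd_n fun J₁ r₁ enc₁ s up₁ hs => ?_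
    refine exists_mem (hW.lift up₁) (hWb.comp r₁) fun J₂ r₂ enc₂ w hw up₂ hw' => ?_
    have hg₂ := (hg.lift up₁).lift up₂
    exact polyComp_covers hg₂ (polyComp_next hg₂ ((hq.lift up₁).lift up₂)
      ((he.lift up₁).lift up₂) (hs.lift up₂)) (hs.lift up₂) ((hfam'.lift up₁).lift up₂)
      (fun _ => hsmall' _) hw' fun _ => hWsmall _ _ (hw _)

theorem polyComp_entry (hg : PolyComp (fun i => (g i).size) enc fun i => (g i).enc)
    {k : I → ℕ} {q : ∀ i, Fin (g i).m} {fam : ∀ i, List (List (Fin (g i).n))} {e : I → ℕ}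
    {succ : ∀ i, Fin (g i).n → ℕ}
    (hk : PolyComp (fun i => (g i).size) enc fun i => .ofNat (k i))
    (hq : PolyComp (fun i => (g i).size) enc fun i => .ofNat (q i : ℕ))
    (hfam : PolyComp (fun i => (g i).size) enc fun i => encFam (fam i))
    (he : PolyComp (fun i => (g i).size) enc fun i => .ofNat (e i))
    (hsucc : ∀ (J : Type) (r : J → I) (enc' : J → Data) (x : ∀ j, Fin (g (r j)).n),
      PolyComp (fun j => (g (r j)).size) enc' (fun j => enc (r j)) →
      PolyComp (fun j => (g (r j)).size) enc' (fun j => .ofNat (x j : ℕ)) →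
      PolyComp (fun j => (g (r j)).size) enc' (fun j => .ofNat (succ (r j) (x j)))) :
    PolyComp (fun i => (g i).size) enc fun i =>
      (Entry.mk (k i) (q i) (fam i) (e i) (succ i)).enc :=
  hk.pair (hq.pair (hfam.pair (he.pair (table (polyComp_n hg) polyBdd_n hsucc))))

theorem polyComp_coverIdx (hg : PolyComp (fun i => (g i).size) enc fun i => (g i).enc)
    {W : ∀ i, List (Entry (g i).n (g i).m)} {q : ∀ i, Fin (g i).m} {s : ∀ i, Fin (g i).n}
    {fam : ∀ i, List (List (Fin (g i).n))}
    (hW : PolyComp (fun i => (g i).size) enc fun i => .ofList ((W i).map Entry.enc))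
    (hWb : PolyBdd (fun i => (g i).size) fun i => (W i).length)
    (hWsmall : ∀ i, ∀ w ∈ W i, SmallFam w.fam)
    (hq : PolyComp (fun i => (g i).size) enc fun i => .ofNat (q i : ℕ))
    (hfam : PolyComp (fun i => (g i).size) enc fun i => encFam (fam i))
    (hsmall : ∀ i, SmallFam (fam i))
    (hs : PolyComp (fun i => (g i).size) enc fun i => .ofNat (s i : ℕ)) :
    PolyComp (fun i => (g i).size) enc fun i =>
      .ofNat (coverIdx (g i).A (W i) (q i) (fam i) (s i)) :=
  lastSat (eb := fun _ => .ofNat) hW hWb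
    (fun _ _ _ _ hw up hw' => polyComp_covers (hg.lift up) (hq.lift up) (hs.lift up)
      (hfam.lift up) (fun _ => hsmall _) hw' fun _ => hWsmall _ _ (hw _))
    (fun _ _ _ _ _ _ hw' => hw'.left) zero

theorem polyComp_families (hg : PolyComp (fun i => (g i).size) enc fun i => (g i).enc) :
    PolyComp (fun i => (g i).size) enc fun i => .ofList ((families (g i).n).map encFam) :=
  (((polyComp_n hg).finRange polyBdd_n).powList (PolyBdd.self.mono fun i => by
    simpa using (g i).two_pow_le_size)).powList (PolyBdd.self.mono fun i => by
      have := length_families (g i).n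
      rw [families, List.length_powList] at this
      rw [this]
      unfold Inst.size
      omega)

theorem polyComp_attrStep (hg : PolyComp (fun i => (g i).size) enc fun i => (g i).enc)
    {W : ∀ i, List (Entry (g i).n (g i).m)} {p : ∀ i, Fin (g i).m × List (List (Fin (g i).n))}
    (hW : PolyComp (fun i => (g i).size) enc fun i => .ofList ((W i).map Entry.enc))
    (hWb : PolyBdd (fun i => (g i).size) fun i => (W i).length)
    (hWsmall : ∀ i, ∀ w ∈ W i, SmallFam w.fam)
    (hq : PolyComp (fun i => (g i).size) enc fun i => .ofNat ((p i).1 : ℕ))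
    (hfam : PolyComp (fun i => (g i).size) enc fun i => encFam (p i).2)
    (hsmall : ∀ i, SmallFam (p i).2) :
    PolyComp (fun i => (g i).size) enc fun i =>
      .ofList ((attrStep (g i).A (g i).T (g i).F (W i) (p i)).map Entry.enc) := by
  refine lastSat (α := fun i => Fin (g i).a) (ea := fun i e => .ofNat (e : ℕ))
    (eb := fun i (W : List (Entry (g i).n (g i).m)) => .ofList (W.map Entry.enc))
    ((polyComp_a hg).finRange polyBdd_a) (polyBdd_a.mono fun i => by simp) ?_ ?_ hW
  · intro J₁ r₁ enc₁ e _ up₁ he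
    refine exists_mem (polyComp_families (hg.lift up₁)) (polyBdd_length_families)
      fun J₂ r₂ enc₂ fam' hf up₂ hf' => ?_
    exact polyComp_canMove ((hg.lift up₁).lift up₂) ((hW.lift up₁).lift up₂)
      ((hWb.comp r₁).comp r₂) (fun _ => hWsmall _) ((hq.lift up₁).lift up₂)
      ((hfam.lift up₁).lift up₂) (fun _ => hsmall _) (he.lift up₂) hf'
      fun _ => smallFam_of_mem_families (hf _)
  · intro J₁ r₁ enc₁ e _ up₁ he
    refine lastSat (eb := fun j (W : List (Entry (g (r₁ j)).n (g (r₁ j)).m)) =>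
      .ofList (W.map Entry.enc)) (polyComp_families (hg.lift up₁)) (polyBdd_length_families)
      ?_ ?_ (hW.lift up₁)
    · intro J₂ r₂ enc₂ fam' hf up₂ hf'
      exact polyComp_canMove ((hg.lift up₁).lift up₂) ((hW.lift up₁).lift up₂)
        ((hWb.comp r₁).comp r₂) (fun _ => hWsmall _) ((hq.lift up₁).lift up₂)
        ((hfam.lift up₁).lift up₂) (fun _ => hsmall _) (he.lift up₂) hf'
        fun _ => smallFam_of_mem_families (hf _)
    · intro J₂ r₂ enc₂ fam' hf up₂ hf'
      have hg₂ := (hg.lift up₁).lift up₂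
      have hW₂ := (hW.lift up₁).lift up₂
      have hq₂ := (hq.lift up₁).lift up₂
      have hWb₂ := (hWb.comp r₁).comp r₂
      refine hW₂.append hWb₂ (PolyComp.cons (polyComp_entry hg₂ (hW₂.length hWb₂) hq₂
        ((hfam.lift up₁).lift up₂) (he.lift up₂) ?_) list_nil)
      intro J₃ r₃ enc₃ s up₃ hs
      exact polyComp_coverIdx (hg₂.lift up₃) (hW₂.lift up₃) (hWb₂.comp r₃)
        (fun _ => hWsmall _)
        (polyComp_next (hg₂.lift up₃) (hq₂.lift up₃) ((he.lift up₂).lift up₃) hs)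
        (hf'.lift up₃) (fun _ => smallFam_of_mem_families (hf _)) hs

/-- Positions as data. -/
def encPosition {n m : ℕ} (p : Fin m × List (List (Fin n))) : Data :=
  .node (.ofNat (p.1 : ℕ)) (encFam p.2)

theorem polyComp_positions (hg : PolyComp (fun i => (g i).size) enc fun i => (g i).enc) :
    PolyComp (fun i => (g i).size) enc fun i =>
      .ofList ((positions (g i).n (g i).m).map encPosition) :=
  flatMap (α := fun i => Fin (g i).m) (ea := fun i q => .ofNat (q : ℕ))
    (eb := fun _ => encPosition) ((polyComp_m hg).finRange polyBdd_m)
    (polyBdd_m.mono fun i => by simp) polyBdd_length_families (fun i q _ => by simp)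
    fun J₁ r₁ enc₁ q _ up₁ hq => map (eb := fun _ => encPosition)
      (polyComp_families (hg.lift up₁)) polyBdd_length_families
      fun J₂ r₂ enc₂ fam _ up₂ hfam => (hq.lift up₂).pair hfam

theorem polyComp_baseEntry (hg : PolyComp (fun i => (g i).size) enc fun i => (g i).enc)
    {q : ∀ i, Fin (g i).m} (hq : PolyComp (fun i => (g i).size) enc fun i => .ofNat (q i : ℕ)) :
    PolyComp (fun i => (g i).size) enc fun i => (baseEntry (g i).A (g i).T (q i)).enc :=
  lastSat (α := fun i => Fin (g i).a) (ea := fun i e => .ofNat (e : ℕ))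
    (eb := fun i (w : Entry (g i).n (g i).m) => w.enc)
    ((polyComp_a hg).finRange polyBdd_a) (polyBdd_a.mono fun i => by simp)
    (fun _ _ _ _ _ up he => polyComp_mem_Act (hg.lift up) (hq.lift up) he)
    (fun _ _ _ _ _ up he => polyComp_entry (hg.lift up) (hq.lift up) (hq.lift up) list_nil he
      fun _ _ _ _ up' hs => polyComp_next ((hg.lift up).lift up') ((hq.lift up).lift up')
        (he.lift up') hs)
    (polyComp_entry hg hq hq list_nil zero fun _ _ _ _ _ _ => zero)

theorem polyComp_initFam (hg : PolyComp (fun i => (g i).size) enc fun i => (g i).enc) :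
    PolyComp (fun i => (g i).size) enc fun i => encFam (initFam (g i).K) := by
  classical
  refine flatMap (α := fun i => Fin (g i).n) (ea := fun i s => .ofNat (s : ℕ))
    (eb := fun i (X : List (Fin (g i).n)) => encSet X)
    ((polyComp_n hg).finRange polyBdd_n) (polyBdd_n.mono fun i => by simp) (.const 1)
    (fun i s _ => by split_ifs <;> simp) fun J r enc' s _ up hs => ?_
  refine ((polyComp_mem_K (hg.lift up) hs).ite (hs.pair nil |>.pair nil) nil).congr fun j => ?_
  split_ifs <;> rfl

end PolyTime

/-! ### The entries of the attractor are positions of the game -/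

section Entries

variable {n a b m : ℕ} {A : Arena (Fin n) (Fin a) (Fin b)}
  {T : ActionAutomaton A.simE (Fin a) (Fin m)} {K F : Set (Fin n)}

theorem baseEntry_cases (q : Fin m) :
    (∃ e, e ∈ T.Act q ∧ baseEntry A T q =
      ⟨q, q, [], e, fun s => (T.next q (e, Quotient.mk A.simE s) : ℕ)⟩) ∨
    ((∀ e, e ∉ T.Act q) ∧ baseEntry A T q = ⟨q, q, [], 0, fun _ => 0⟩) := by
  obtain ⟨e, -, he, h⟩ | ⟨h, h'⟩ := List.lastSat_cases (p := fun e => e ∈ T.Act q)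
    (f := fun e => (⟨q, q, [], e, fun s => (T.next q (e, Quotient.mk A.simE s) : ℕ)⟩ : Entry n m))
    (d := ⟨q, q, [], 0, fun _ => 0⟩) (List.finRange a)
  · exact .inl ⟨e, he, h⟩
  · exact .inr ⟨fun e => h e (List.mem_finRange e), h'⟩

theorem baseEntry_idx (q : Fin m) : (baseEntry A T q).idx = q := by
  obtain ⟨e, -, h⟩ | ⟨-, h⟩ := baseEntry_cases (A := A) (T := T) q <;> rw [h]

theorem baseEntry_q (q : Fin m) : (baseEntry A T q).q = q := by
  obtain ⟨e, -, h⟩ | ⟨-, h⟩ := baseEntry_cases (A := A) (T := T) q <;> rw [h]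

theorem baseEntry_fam (q : Fin m) : (baseEntry A T q).fam = [] := by
  obtain ⟨e, -, h⟩ | ⟨-, h⟩ := baseEntry_cases (A := A) (T := T) q <;> rw [h]

theorem mem_positions {p : Fin m × List (List (Fin n))} :
    p ∈ positions n m ↔ p.2 ∈ families n := by
  simp only [positions, List.mem_flatMap, List.mem_finRange, true_and, List.mem_map]
  exact ⟨by rintro ⟨q, fam, h, rfl⟩; exact h, fun h => ⟨p.1, p.2, h, rfl⟩⟩

theorem fam_mem_families_of_foldl {l : List (Fin m × List (List (Fin n)))}
    (hl : ∀ p ∈ l, p.2 ∈ families n) {W : List (Entry n m)} (hW : ∀ w ∈ W, w.fam ∈ families n) :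
    ∀ w ∈ l.foldl (attrStep A T F) W, w.fam ∈ families n := by
  induction l generalizing W with
  | nil => exact hW
  | cons p l ih =>
    refine ih (fun p' hp' => hl p' (List.mem_cons_of_mem _ hp')) fun w hw => ?_
    obtain ⟨e, f, -, -, h⟩ | ⟨-, h⟩ := attrStep_cases (A := A) (T := T) (F := F) W p
    · rw [h, List.mem_append, List.mem_singleton] at hw
      obtain hw | rfl := hw
      · exact hW w hw
      · exact hl p (by simp)
    · exact hW w (h ▸ hw)

theorem fam_mem_families_of_mem_base {w : Entry n m}
    (hw : w ∈ (List.finRange m).map (baseEntry A T)) : w.fam ∈ families n := by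
  obtain ⟨q, -, rfl⟩ := List.mem_map.1 hw
  rw [baseEntry_fam]
  exact List.nil_mem_powList _

theorem fam_mem_families {w : Entry n m} (hw : w ∈ attractor A T F) : w.fam ∈ families n := by
  refine fam_mem_families_of_foldl (fun p hp => ?_) (fun w => fam_mem_families_of_mem_base) w hw
  obtain ⟨-, -, hp⟩ := List.mem_flatMap.1 hp
  exact mem_positions.1 hp

end Entries

/-! ### The decision procedure and the construction of a strategy -/

section PolyTime

open PolyComp

variable {I : Type} {enc : I → Data} {g : I → Inst}

theorem polyComp_attractor (hg : PolyComp (fun i => (g i).size) enc fun i => (g i).enc) :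
    PolyComp (fun i => (g i).size) enc fun i =>
      .ofList ((attractor (g i).A (g i).T (g i).F).map Entry.enc) := by
  have hlen : PolyBdd (fun i => (g i).size) fun i =>
      ((positions (g i).n (g i).m).flatMap fun _ => positions (g i).n (g i).m).length :=
    (polyBdd_length_positions.mul polyBdd_length_positions).mono fun i => by simp
  refine foldl (α := fun i => Fin (g i).m × List (List (Fin (g i).n))) (ea := fun _ => encPosition)
    (β := fun i => List (Entry (g i).n (g i).m)) (eb := fun i W => .ofList (W.map Entry.enc))
    (F := fun i => attrStep (g i).A (g i).T (g i).F)
    (b := fun i => (List.finRange (g i).m).map (baseEntry (g i).A (g i).T))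
    (flatMap (ea := fun _ => encPosition) (eb := fun _ => encPosition) (polyComp_positions hg)
      polyBdd_length_positions
      polyBdd_length_positions (fun _ _ _ => le_rfl)
      fun _ _ _ _ _ up _ => polyComp_positions (hg.lift up))
    hlen ?_ ?_
  · exact map (α := fun i => Fin (g i).m) (ea := fun i q => .ofNat (q : ℕ))
      (β := fun i => Entry (g i).n (g i).m) (eb := fun i w => Entry.enc w)
      (F := fun i => baseEntry (g i).A (g i).T)
      ((polyComp_m hg).finRange polyBdd_m) (polyBdd_m.mono fun i => by simp)
      fun _ _ _ _ _ up hq => polyComp_baseEntry (hg.lift up) hq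
  · intro J r enc' p W hp hW up hp' hW'
    have hfam : ∀ j, (p j).2 ∈ families _ := fun j => by
      obtain ⟨-, -, h⟩ := List.mem_flatMap.1 (hp j)
      exact mem_positions.1 h
    refine polyComp_attrStep (hg.lift up) hW' (((polyBdd_m.add hlen).comp r).mono fun j => ?_)
      (fun j w hw => smallFam_of_mem_families ?_) hp'.left hp'.right
      fun j => smallFam_of_mem_families (hfam j)
    · obtain ⟨L₁, h1, h2⟩ := hW j
      rw [h2]
      refine (length_foldl_attrStep _ _).trans ?_
      rw [List.length_map, List.length_finRange]
      exact Nat.add_le_add_left h1.length_le _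
    · obtain ⟨L₁, h1, h2⟩ := hW j
      rw [h2] at hw
      refine fam_mem_families_of_foldl (fun p hp => ?_) (fun w => fam_mem_families_of_mem_base) w hw
      obtain ⟨-, -, h⟩ := List.mem_flatMap.1 (h1.subset hp)
      exact mem_positions.1 h

theorem polyBdd_length_attractor :
    PolyBdd (fun i => (g i).size) fun i => (attractor (g i).A (g i).T (g i).F).length :=
  (polyBdd_m.add (polyBdd_length_positions.mul polyBdd_length_positions)).mono fun i => by
    simpa [length_positions] using length_attractor

theorem polyComp_solvable (hg : PolyComp (fun i => (g i).size) enc fun i => (g i).enc) :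
    PolyComp (fun i => (g i).size) enc fun i =>
      .ofProp (Solvable (g i).A (g i).T (g i).K (g i).F) := by
  refine (((polyComp_a hg).nat_le zero (.const 0)).not.congr_prop fun i => by
    rw [not_le]).and ?_
  refine forall_fin (polyComp_n hg) polyBdd_n fun J₁ r₁ enc₁ s up₁ hs => ?_
  refine exists_mem (polyComp_attractor (hg.lift up₁)) polyBdd_length_attractor
    fun J₂ r₂ enc₂ w hw up₂ hw' => ?_
  have hg₂ := (hg.lift up₁).lift up₂
  exact polyComp_covers hg₂ (polyComp_init hg₂) (hs.lift up₂) (polyComp_initFam hg₂)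
    (fun _ => smallFam_initFam) hw' fun j => smallFam_of_mem_families (fam_mem_families (hw j))

/-- The output of the program that constructs a strategy. -/
def Inst.output (g : Inst) : Data :=
  .ofList
    [.ofNat (memoryEntries g.A g.T g.K g.F).length,
      .ofNat (attractor g.A g.T g.F).length,
      .ofList ((memoryEntries g.A g.T g.K g.F).map fun w => .table fun s => .ofNat (w.succ s)),
      .ofList ((memoryEntries g.A g.T g.K g.F).map fun w => .ofNat w.act)]

theorem polyComp_output (hg : PolyComp (fun i => (g i).size) enc fun i => (g i).enc) :
    PolyComp (fun i => (g i).size) enc fun i => (g i).output := by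
  have hW := polyComp_attractor hg
  have hlen : PolyBdd (fun i => (g i).size) fun i =>
      (attractor (g i).A (g i).T (g i).F).length := polyBdd_length_attractor
  have hM : PolyComp (fun i => (g i).size) enc fun i =>
      .ofList ((memoryEntries (g i).A (g i).T (g i).K (g i).F).map Entry.enc) :=
    hW.append hlen (PolyComp.cons (polyComp_entry hg (hW.length hlen) (polyComp_init hg) list_nil
      zero fun J r enc' s up hs => polyComp_coverIdx (hg.lift up) (hW.lift up) (hlen.comp r)
        (fun j w hw => smallFam_of_mem_families (fam_mem_families hw)) (polyComp_init (hg.lift up))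
        (polyComp_initFam (hg.lift up)) (fun _ => smallFam_initFam) hs) list_nil)
  have hMlen : PolyBdd (fun i => (g i).size) fun i =>
      (memoryEntries (g i).A (g i).T (g i).K (g i).F).length :=
    (hlen.add (.const 1)).mono fun i => by simp [memoryEntries]
  refine (hM.length hMlen).pair ((hW.length hlen).pair (PolyComp.pair ?_ (PolyComp.pair ?_ nil)))
  · exact (map (eb := fun _ => _root_.id)
      (F := fun i (w : Entry (g i).n (g i).m) => Data.table fun s => .ofNat (w.succ s)) hM hMlen
      fun J r enc' w _ _ hw => hw.right.right.right.right).congr fun i => by rw [List.map_id]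
  · exact (map (eb := fun _ => _root_.id)
      (F := fun i (w : Entry (g i).n (g i).m) => Data.ofNat w.act) hM hMlen
      fun J r enc' w _ _ hw => hw.right.right.right.left).congr fun i => by rw [List.map_id]

end PolyTime

/-! ### Positive probability and plays all of whose steps are possible -/

namespace Arena

variable {S ActE ActA : Type*}

theorem obsHistory_zero (r : Setoid S) (ω : ℕ → S) :
    obsHistory r 0 (fun i => ω i) = [Quotient.mk r (ω 0)] := by
  simp [obsHistory]

theorem obsHistory_succ (r : Setoid S) (k : ℕ) (ω : ℕ → S) :
    obsHistory r (k + 1) (fun i => ω i) =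
      obsHistory r k (fun i => ω i) ++ [Quotient.mk r (ω (k + 1))] := by
  unfold obsHistory
  rw [List.ofFn_succ_last]
  rfl

theorem obsHistory_congr (r : Setoid S) {k : ℕ} {ω ω' : ℕ → S} (h : ∀ i ≤ k, ω i = ω' i) :
    obsHistory r k (fun i => ω i) = obsHistory r k (fun i => ω' i) := by
  unfold obsHistory
  congr 1
  funext i
  exact congrArg _ (h i (Nat.lt_succ_iff.1 i.2))

variable (A : Arena S ActE ActA)

/-- The step from `ω k` to `ω (k + 1)` is possible if both players follow their strategies. -/
def StepPossible (φ : A.EveStrategy) (ψ : A.AdamStrategy) (ω : ℕ → S) (k : ℕ) : Prop :=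
  0 < A.δ (ω k) (φ (obsHistory A.simE k fun i => ω i)) (ψ (obsHistory A.simA k fun i => ω i))
    (ω (k + 1))

variable {A}

theorem StepPossible.congr {φ : A.EveStrategy} {ψ : A.AdamStrategy} {ω ω' : ℕ → S} {k : ℕ}
    (hs : A.StepPossible φ ψ ω k) (h : ∀ i ≤ k + 1, ω i = ω' i) : A.StepPossible φ ψ ω' k := by
  have h' : ∀ i ≤ k, ω i = ω' i := fun i hi => h i (hi.trans (Nat.le_succ k))
  unfold StepPossible at hs ⊢
  rwa [obsHistory_congr A.simE h', obsHistory_congr A.simA h', h' k le_rfl, h (k + 1) le_rfl] at hs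

variable [Finite S] [MeasurableSpace S] [DiscreteMeasurableSpace S]
  (s₀ : S) (φ : A.EveStrategy) (ψ : A.AdamStrategy)

instance : IsProbabilityMeasure (A.stateLaw s₀ φ ψ) := by
  unfold stateLaw
  infer_instance

/-- The next state is distributed according to the transition probabilities, given the history. -/
theorem stateLaw_succ (k : ℕ) (P : (Finset.Iic k → S) → S → Prop) :
    A.stateLaw s₀ φ ψ {ω | P (fun i => ω i) (ω (k + 1))} =
      ∫⁻ ω, A.stepKernel φ ψ k (fun i => ω i) {s | P (fun i => ω i) s} ∂A.stateLaw s₀ φ ψ := by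
  let κ := A.stepKernel φ ψ
  let x₀ : Finset.Iic 0 → S := fun _ => s₀
  have hE : MeasurableSet {ω : ℕ → S | P (fun i => ω i) (ω (k + 1))} := by
    have hm : Measurable fun ω : ℕ → S => ((fun i : Finset.Iic k => ω i), ω (k + 1)) := by
      fun_prop
    exact hm (Set.toFinite {p : (Finset.Iic k → S) × S | P p.1 p.2}).measurableSet
  have h1 : A.stateLaw s₀ φ ψ {ω | P (fun i => ω i) (ω (k + 1))} =
      ∫⁻ h, Kernel.traj (X := fun _ => S) κ k h {ω | P (fun i => ω i) (ω (k + 1))}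
        ∂Kernel.partialTraj (X := fun _ => S) κ 0 k x₀ := by
    rw [← Kernel.comp_apply' _ _ _ hE, Kernel.traj_comp_partialTraj (Nat.zero_le k)]
    rfl
  rw [h1, ← Kernel.traj_map_frestrictLe_apply, lintegral_map (measurable_of_finite _) (by fun_prop)]
  refine lintegral_congr fun ω => ?_
  set h := Preorder.frestrictLe (π := fun _ => S) k ω
  have hae : ∀ᵐ ω' ∂Kernel.traj (X := fun _ => S) κ k h,
      Preorder.frestrictLe (π := fun _ => S) k ω' = h := by
    have := Kernel.traj_map_frestrictLe_apply (X := fun _ => S) (κ := κ) k k h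
    rw [Kernel.partialTraj_self, Kernel.id_apply] at this
    refine ae_of_ae_map (f := Preorder.frestrictLe (π := fun _ => S) k) (p := fun x => x = h)
      (by fun_prop) ?_
    rw [this, ae_dirac_iff (Set.toFinite _).measurableSet]
  have h2 : Kernel.traj (X := fun _ => S) κ k h {ω' | P (fun i => ω' i) (ω' (k + 1))} =
      Kernel.traj (X := fun _ => S) κ k h ((fun ω' => ω' (k + 1)) ⁻¹' {s | P h s}) := by
    refine measure_congr ?_
    filter_upwards [hae] with ω' hω'
    exact congrArg (fun x => P x (ω' (k + 1))) hω'
  have h3 := congrArg (fun η => η h {s | P h s})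
    (Kernel.map_traj_succ_self (X := fun _ => S) (κ := κ) (a := k))
  rw [h2]
  rw [Kernel.map_apply' _ (by fun_prop) _ (Set.toFinite _).measurableSet] at h3
  exact h3

theorem ae_zero_eq : ∀ᵐ ω ∂A.stateLaw s₀ φ ψ, ω 0 = s₀ := by
  have h := Kernel.traj_map_frestrictLe_apply (X := fun _ => S) (κ := A.stepKernel φ ψ) 0 0
    (fun _ => s₀)
  rw [Kernel.partialTraj_self, Kernel.id_apply] at h
  have : ∀ᵐ ω ∂A.stateLaw s₀ φ ψ, Preorder.frestrictLe (π := fun _ => S) 0 ω = fun _ => s₀ := by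
    refine ae_of_ae_map (f := Preorder.frestrictLe (π := fun _ => S) 0)
      (p := fun x => x = fun _ => s₀) (by fun_prop) ?_
    rw [stateLaw, h, ae_dirac_iff (Set.toFinite _).measurableSet]
  filter_upwards [this] with ω hω
  exact congrFun hω ⟨0, by simp⟩

theorem ae_stepPossible (k : ℕ) : ∀ᵐ ω ∂A.stateLaw s₀ φ ψ, A.StepPossible φ ψ ω k := by
  have h := stateLaw_succ s₀ φ ψ k fun h s =>
    ¬ 0 < A.δ (h ⟨k, by simp⟩) (φ (obsHistory A.simE k h)) (ψ (obsHistory A.simA k h)) s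
  refine h.trans (lintegral_eq_zero_of_ae_eq_zero (.of_forall fun ω => ?_))
  change (PMF.toMeasure _) _ = 0
  rw [PMF.toMeasure_apply_eq_zero_iff _ (Set.toFinite _).measurableSet, Set.disjoint_left]
  intro s hs hs'
  exact hs' (pos_iff_ne_zero.2 hs)

theorem stateLaw_cylinder_pos {h : ℕ → S} (h0 : h 0 = s₀) (k : ℕ)
    (hk : ∀ i < k, A.StepPossible φ ψ h i) :
    0 < A.stateLaw s₀ φ ψ {ω | ∀ i ≤ k, ω i = h i} := by
  induction k with
  | zero =>
    have hae : ∀ᵐ ω ∂A.stateLaw s₀ φ ψ, ∀ i ≤ 0, ω i = h i := by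
      filter_upwards [ae_zero_eq s₀ φ ψ] with ω hω i hi
      rw [Nat.le_zero.1 hi, hω, h0]
    rw [(measure_congr (Filter.eventuallyEq_univ.2 hae)).trans measure_univ]
    exact one_pos
  | succ k ih =>
    have ih := ih fun i hi => hk i (by omega)
    have h1 : {ω : ℕ → S | ∀ i ≤ k + 1, ω i = h i} =
        {ω | (fun x s => (x = fun i : Finset.Iic k => h i) ∧ s = h (k + 1))
          (fun i : Finset.Iic k => ω i) (ω (k + 1))} := by
      ext ω
      simp only [Set.mem_ofPred_eq, funext_iff, Subtype.forall, Finset.mem_Iic]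
      exact ⟨fun H => ⟨fun i hi => H i (by omega), H _ le_rfl⟩, fun H i hi =>
        (Nat.le_succ_iff.1 hi).elim (H.1 i) fun e => e ▸ H.2⟩
    rw [h1, stateLaw_succ s₀ φ ψ k fun x s => (x = fun i : Finset.Iic k => h i) ∧ s = h (k + 1)]
    have hm : MeasurableSet {ω : ℕ → S | ∀ i ≤ k, ω i = h i} := by
      have : {ω : ℕ → S | ∀ i ≤ k, ω i = h i} = ⋂ i ≤ k, (fun ω => ω i) ⁻¹' {h i} := by
        ext; simp
      rw [this]
      exact .iInter fun i => .iInter fun _ => measurable_pi_apply i (measurableSet_singleton _)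
    refine lt_of_lt_of_le (ENNReal.mul_pos (hk k (Nat.lt_succ_self k)).ne' ih.ne')
      (le_trans ?_ (setLIntegral_le_lintegral {ω : ℕ → S | ∀ i ≤ k, ω i = h i} _))
    rw [← setLIntegral_const]
    refine setLIntegral_mono' hm fun ω hω => ?_
    have hω' : (fun i : Finset.Iic k => ω i) = fun i : Finset.Iic k => h i :=
      funext fun i => hω i (Finset.mem_Iic.1 i.2)
    simp only [hω', true_and, Set.ofPred_eq_eq_singleton]
    change _ ≤ (PMF.toMeasure _) {h (k + 1)}
    rw [PMF.toMeasure_apply_singleton _ _ (measurableSet_singleton _)]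

variable {s₀ φ ψ}

theorem prob_reach_pos {F : Set S} {h : ℕ → S} (h0 : h 0 = s₀) {k : ℕ}
    (hk : ∀ i < k, A.StepPossible φ ψ h i) (hF : h k ∈ F) : 0 < A.prob s₀ φ ψ (Reach F) :=
  (stateLaw_cylinder_pos s₀ φ ψ h0 k hk).trans_le <| measure_mono fun ω hω =>
    ⟨k, by change ω k ∈ F; rw [hω k le_rfl]; exact hF⟩

theorem exists_play_of_prob_pos {F : Set S} (h : 0 < A.prob s₀ φ ψ (Reach F)) :
    ∃ ω : ℕ → S, ω 0 = s₀ ∧ (∀ k, A.StepPossible φ ψ ω k) ∧ ∃ k, ω k ∈ F := by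
  by_contra! hne
  refine h.ne' (measure_mono_null (t := {ω | ω 0 = s₀ → ¬ ∀ k, A.StepPossible φ ψ ω k}) ?_ ?_)
  · rintro ω ⟨k, hk⟩ h0 hs
    exact hne ω h0 hs k hk
  · have := (ae_zero_eq s₀ φ ψ).and (ae_all_iff.2 (ae_stepPossible s₀ φ ψ))
    refine measure_mono_null (fun ω hω => ?_) this
    simpa using hω

end Arena

/-! ### The attractor is closed, and all its entries are justified -/

section Attractor

variable {n a b m : ℕ} {A : Arena (Fin n) (Fin a) (Fin b)}
  {T : ActionAutomaton A.simE (Fin a) (Fin m)} {F : Set (Fin n)}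

theorem Covers.congr_class {q : Fin m} {s s' : Fin n} (h : A.simE s s')
    (fam : List (List (Fin n))) : Covers (m := m) A q s fam = Covers A q s' fam := by
  have : ∀ t, A.simE s t ↔ A.simE s' t := fun t =>
    ⟨A.simE.trans (A.simE.symm h), A.simE.trans h⟩
  funext w
  simp only [Covers, this]

theorem coverIdx_congr {W : List (Entry n m)} {q : Fin m} {s s' : Fin n} (h : A.simE s s')
    (fam : List (List (Fin n))) : coverIdx A W q fam s = coverIdx A W q fam s' := by
  rw [coverIdx, coverIdx, Covers.congr_class h]

theorem exists_coverIdx_eq {W : List (Entry n m)} {q : Fin m} {s : Fin n}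
    {fam : List (List (Fin n))} (h : ∃ w ∈ W, Covers A q s fam w) :
    ∃ w ∈ W, Covers A q s fam w ∧ coverIdx A W q fam s = w.idx :=
  List.exists_lastSat_eq h

variable (A T F) in
/-- The entry `w` is a base entry, or there is a move of Eve from its position whose successors
are earlier entries of `W`. -/
def Justified (W : List (Entry n m)) (w : Entry n m) : Prop :=
  (∃ q, w = baseEntry A T q) ∨
  ∃ e fam', e ∈ T.Act w.q ∧ w.act = e ∧ (∀ B ∈ w.fam, Secured A F e fam' B) ∧
    (∀ s s', A.simE s s' → w.succ s = w.succ s') ∧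
    ∀ s, ∃ w' ∈ W, w'.idx < w.idx ∧ w.succ s = w'.idx ∧
      Covers A (T.next w.q (e, Quotient.mk A.simE s)) s fam' w'

theorem Justified.mono {W W' : List (Entry n m)} {w : Entry n m} (h : Justified A T F W w)
    (hW : W ⊆ W') : Justified A T F W' w := by
  obtain h | ⟨e, fam', h1, h2, h3, h4, h5⟩ := h
  · exact .inl h
  · refine .inr ⟨e, fam', h1, h2, h3, h4, fun s => ?_⟩
    obtain ⟨w', hw', h⟩ := h5 s
    exact ⟨w', hW hw', h⟩

variable (A T F) in
/-- The invariant of the construction of the attractor: entries carry their position in the list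
as number, all base entries are present, and all entries are justified. -/
structure WellFormed (W : List (Entry n m)) : Prop where
  idx_eq : ∀ (i : ℕ) (w : Entry n m), W[i]? = some w → w.idx = i
  base_mem : ∀ q, baseEntry A T q ∈ W
  justified : ∀ w ∈ W, Justified A T F W w

theorem WellFormed.getElem?_idx {W : List (Entry n m)} (h : WellFormed A T F W) {w : Entry n m}
    (hw : w ∈ W) : W[w.idx]? = some w := by
  obtain ⟨i, hi⟩ := List.mem_iff_getElem?.1 hw
  rwa [h.idx_eq i w hi]

theorem WellFormed.idx_lt {W : List (Entry n m)} (h : WellFormed A T F W) {w : Entry n m}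
    (hw : w ∈ W) : w.idx < W.length :=
  (List.getElem?_eq_some_iff.1 (h.getElem?_idx hw)).1

theorem wellFormed_base : WellFormed A T F ((List.finRange m).map (baseEntry A T)) where
  idx_eq i w h := by
    obtain ⟨q, hq, rfl⟩ := List.getElem?_map .. ▸ h |> Option.map_eq_some_iff.1
    obtain ⟨hi, rfl⟩ := List.getElem?_eq_some_iff.1 hq
    simp [baseEntry_idx]
  base_mem q := List.mem_map_of_mem (List.mem_finRange q)
  justified w hw := by
    obtain ⟨q, -, rfl⟩ := List.mem_map.1 hw
    exact .inl ⟨q, rfl⟩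

theorem WellFormed.attrStep {W : List (Entry n m)} (h : WellFormed A T F W)
    (p : Fin m × List (List (Fin n))) : WellFormed A T F (attrStep A T F W p) := by
  obtain ⟨e, fam', -, ⟨hact, hsec, hcov⟩, h'⟩ | ⟨-, h'⟩ :=
    attrStep_cases (A := A) (T := T) (F := F) W p
  swap
  · rwa [h']
  rw [h']
  refine ⟨fun i w hw => ?_, fun q => List.mem_append_left _ (h.base_mem q), fun w hw => ?_⟩
  · rw [List.getElem?_append] at hw
    split_ifs at hw with hi
    · exact h.idx_eq i w hw
    · obtain ⟨hi', rfl⟩ := List.getElem?_eq_some_iff.1 hw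
      simp only [List.length_singleton] at hi'
      simp only [List.getElem_singleton, moveEntry]
      omega
  · obtain hw | hw := List.mem_append.1 hw
    · exact (h.justified w hw).mono (List.subset_append_left _ _)
    · obtain rfl := List.mem_singleton.1 hw
      refine .inr ⟨e, fam', hact, rfl, hsec, fun s s' hs => ?_, fun s => ?_⟩
      · have : (Quotient.mk A.simE s) = Quotient.mk A.simE s' := Quotient.sound hs
        simp only [moveEntry, this, coverIdx_congr hs]
      · obtain ⟨w', hw', hc, hidx⟩ := exists_coverIdx_eq (hcov s)
        exact ⟨w', List.mem_append_left _ hw', h.idx_lt hw', hidx, hc⟩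

theorem WellFormed.foldl {W : List (Entry n m)} (h : WellFormed A T F W)
    (l : List (Fin m × List (List (Fin n)))) :
    WellFormed A T F (l.foldl (_root_.attrStep A T F) W) := by
  induction l generalizing W with
  | nil => exact h
  | cons p l ih => exact ih (h.attrStep p)

theorem wellFormed_attractor : WellFormed A T F (attractor A T F) :=
  wellFormed_base.foldl _

/-- Whether Eve can move into `W` only depends on the positions in `W`. -/
theorem CanMove.mono {W W' : List (Entry n m)} {q : Fin m} {fam : List (List (Fin n))} {e : Fin a}
    {fam' : List (List (Fin n))} (h : CanMove A T F W q fam e fam')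
    (hW : ∀ w ∈ W, ∃ w' ∈ W', w'.q = w.q ∧ w'.fam = w.fam) : CanMove A T F W' q fam e fam' := by
  refine ⟨h.1, h.2.1, fun s => ?_⟩
  obtain ⟨w, hw, hc⟩ := h.2.2 s
  obtain ⟨w', hw', h1, h2⟩ := hW w hw
  exact ⟨w', hw', by rw [Covers, h1, h2]; exact hc⟩

variable (A T F) in
/-- Every position from which Eve can move into `W` is in `W`. -/
def IsClosedAttr (W : List (Entry n m)) : Prop :=
  ∀ p ∈ positions n m, ∀ e, ∀ fam' ∈ families n, CanMove A T F W p.1 p.2 e fam' →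
    ∃ w ∈ W, w.q = p.1 ∧ w.fam = p.2

/-- The positions of the entries. -/
def keys (W : List (Entry n m)) : Finset (Fin m × List (List (Fin n))) :=
  (W.map fun w => (w.q, w.fam)).toFinset

theorem mem_keys {W : List (Entry n m)} {p : Fin m × List (List (Fin n))} :
    p ∈ keys W ↔ ∃ w ∈ W, w.q = p.1 ∧ w.fam = p.2 := by
  simp [keys, Prod.ext_iff]

theorem subset_attrStep (W : List (Entry n m)) (p : Fin m × List (List (Fin n))) :
    W ⊆ attrStep A T F W p := by
  obtain ⟨e, f, -, -, h⟩ | ⟨-, h⟩ := attrStep_cases (A := A) (T := T) (F := F) W p <;> rw [h]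
  · exact List.subset_append_left _ _
  · exact List.Subset.refl _

theorem subset_foldl_attrStep (l : List (Fin m × List (List (Fin n)))) (W : List (Entry n m)) :
    W ⊆ l.foldl (attrStep A T F) W := by
  induction l generalizing W with
  | nil => exact List.Subset.refl _
  | cons p l ih => exact List.Subset.trans (subset_attrStep W p) (ih _)

theorem mem_keys_foldl {l : List (Fin m × List (List (Fin n)))} {p : Fin m × List (List (Fin n))}
    (hp : p ∈ l) {W : List (Entry n m)} {e : Fin a} {fam' : List (List (Fin n))}
    (hf : fam' ∈ families n) (h : CanMove A T F W p.1 p.2 e fam') :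
    p ∈ keys (l.foldl (attrStep A T F) W) := by
  obtain ⟨l₁, l₂, rfl⟩ := List.append_of_mem hp
  rw [List.foldl_append, List.foldl_cons]
  have h' := h.mono (W' := l₁.foldl (attrStep A T F) W) fun w hw =>
    ⟨w, subset_foldl_attrStep l₁ W hw, rfl, rfl⟩
  obtain ⟨e, f, -, -, heq⟩ | ⟨hne, -⟩ :=
    attrStep_cases (A := A) (T := T) (F := F) (l₁.foldl (attrStep A T F) W) p
  · refine mem_keys.2 ⟨_, subset_foldl_attrStep l₂ _ (heq ▸ List.mem_append_right _
      (List.mem_singleton_self _)), rfl, rfl⟩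
  · exact absurd ⟨e, fam', hf, h'⟩ hne

theorem IsClosedAttr.attrStep {W : List (Entry n m)} (h : IsClosedAttr A T F W)
    {p : Fin m × List (List (Fin n))} (hp : p ∈ positions n m) :
    IsClosedAttr A T F (attrStep A T F W p) := by
  obtain ⟨e, fam', hf, hm, heq⟩ | ⟨-, heq⟩ := attrStep_cases (A := A) (T := T) (F := F) W p
  swap
  · rwa [heq]
  intro p' hp' e' f' hf' hm'
  obtain ⟨w, hw, h'⟩ := h p' hp' e' f' hf' (hm'.mono fun w hw => by
    rw [heq] at hw
    obtain hw | hw := List.mem_append.1 hw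
    · exact ⟨w, hw, rfl, rfl⟩
    · obtain rfl := List.mem_singleton.1 hw
      exact h p hp e fam' hf hm)
  exact ⟨w, subset_attrStep W p hw, h'⟩

theorem IsClosedAttr.foldl {W : List (Entry n m)} (h : IsClosedAttr A T F W)
    {l : List (Fin m × List (List (Fin n)))} (hl : l ⊆ positions n m) :
    IsClosedAttr A T F (l.foldl (_root_.attrStep A T F) W) := by
  induction l generalizing W with
  | nil => exact h
  | cons p l ih => exact ih (h.attrStep (hl (by simp))) fun x hx => hl (by simp [hx])

/-- As long as the attractor is not closed, each round adds a new position. -/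
theorem isClosedAttr_or_le_card {α : Type} (l : List α) (W : List (Entry n m)) :
    IsClosedAttr A T F (l.foldl (fun W _ => (positions n m).foldl (attrStep A T F) W) W) ∨
    l.length ≤
      (keys (l.foldl (fun W _ => (positions n m).foldl (attrStep A T F) W) W)).card := by
  induction l using List.reverseRecOn with
  | nil => exact .inr (Nat.zero_le _)
  | append_singleton l x ih =>
    rw [List.foldl_append, List.foldl_cons, List.foldl_nil]
    by_cases hc : IsClosedAttr A T F
      (l.foldl (fun W _ => (positions n m).foldl (attrStep A T F) W) W)
    · exact .inl (hc.foldl fun _ h => h)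
    have ih := ih.resolve_left hc
    refine .inr ?_
    unfold IsClosedAttr at hc
    push Not at hc
    obtain ⟨p, hp, e, fam', hf, hm, hne⟩ := hc
    rw [List.length_append, List.length_singleton]
    refine (Nat.succ_le_succ ih).trans (Nat.succ_le_of_lt (Finset.card_lt_card
      ((Finset.ssubset_iff_of_subset fun p' hp' => ?_).2 ⟨p, mem_keys_foldl hp hf hm, ?_⟩)))
    · obtain ⟨w, hw, h⟩ := mem_keys.1 hp'
      exact mem_keys.2 ⟨w, subset_foldl_attrStep _ _ hw, h⟩
    · rw [mem_keys]
      rintro ⟨w, hw, h1, h2⟩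
      exact hne w hw h1 h2

theorem isClosedAttr_attractor : IsClosedAttr A T F (attractor A T F) := by
  have heq : attractor A T F = (positions n m).foldl
      (fun W _ => (positions n m).foldl (attrStep A T F) W)
      ((List.finRange m).map (baseEntry A T)) := by
    rw [attractor, List.foldl_flatMap]
  have hsub : keys (attractor A T F) ⊆ (positions n m).toFinset := fun p hp => by
    obtain ⟨w, hw, -, h2⟩ := mem_keys.1 hp
    exact List.mem_toFinset.2 (mem_positions.2 (h2 ▸ fam_mem_families hw))
  obtain h | h := isClosedAttr_or_le_card (A := A) (T := T) (F := F) (positions n m)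
    ((List.finRange m).map (baseEntry A T))
  · rwa [heq]
  · rw [← heq] at h
    intro p hp e fam' _ _
    rw [← mem_keys, Finset.eq_of_subset_of_card_le hsub ((List.toFinset_card_le _).trans h)]
    exact List.mem_toFinset.2 hp

end Attractor

/-! ### The memory automaton read off the attractor is a winning strategy -/

section Soundness

variable {n a b m : ℕ} {A : Arena (Fin n) (Fin a) (Fin b)}
  {T : ActionAutomaton A.simE (Fin a) (Fin m)} {K F : Set (Fin n)}

theorem ActionAutomaton.next_ne_sink {r : Setoid (Fin n)} {T : ActionAutomaton r (Fin a) (Fin m)}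
    {q : Fin m} {e : Fin a} (he : e ∈ T.Act q) (x : Quotient r) : T.next q (e, x) ≠ T.sink :=
  fun h => (T.next_eq_sink_iff q e x).1 h he

theorem ActionAutomaton.ne_sink_of_mem_Act {r : Setoid (Fin n)}
    {T : ActionAutomaton r (Fin a) (Fin m)} {q : Fin m} {e : Fin a} (he : e ∈ T.Act q) :
    q ≠ T.sink := fun h => by
  rw [(T.act_eq_empty_iff q).2 h] at he
  exact he

theorem mem_initFam {X : List (Fin n)} : X ∈ initFam K ↔ ∃ s ∈ K, X = [s] := by
  classical
  simp only [initFam, List.mem_flatMap, List.mem_finRange, true_and]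
  refine exists_congr fun s => ?_
  split_ifs with h <;> simp [h]

/-- An entry with obligations is not a base entry: Eve has a move to earlier entries. -/
theorem Justified.of_fam_ne_nil {W : List (Entry n m)} {w : Entry n m} (h : Justified A T F W w)
    (hne : w.fam ≠ []) : ∃ e fam', e ∈ T.Act w.q ∧ w.act = e ∧
      (∀ B ∈ w.fam, Secured A F e fam' B) ∧ ∀ s, ∃ w' ∈ W, w'.idx < w.idx ∧ w.succ s = w'.idx ∧
        Covers A (T.next w.q (e, Quotient.mk A.simE s)) s fam' w' := by
  obtain ⟨q, rfl⟩ | ⟨e, fam', h1, h2, h3, -, h5⟩ := h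
  · exact absurd (baseEntry_fam q) hne
  · exact ⟨e, fam', h1, h2, h3, h5⟩

/-- The action of an entry is allowed, and its successors follow the automaton. -/
theorem WellFormed.act_mem {W : List (Entry n m)} (hW : WellFormed A T F W) {w : Entry n m}
    (hw : w ∈ W) (hs : w.q ≠ T.sink) : ∃ e ∈ T.Act w.q, w.act = e ∧
      ∀ s, ∃ w' ∈ W, w.succ s = w'.idx ∧ w'.q = T.next w.q (e, Quotient.mk A.simE s) := by
  obtain ⟨q, rfl⟩ | ⟨e, fam', h1, h2, -, -, h5⟩ := hW.justified w hw
  · rw [baseEntry_q] at hs ⊢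
    obtain ⟨e, he, h⟩ | ⟨h, -⟩ := baseEntry_cases (A := A) (T := T) q
    · exact ⟨e, he, by rw [h], fun s => ⟨baseEntry A T (T.next q (e, Quotient.mk A.simE s)),
        hW.base_mem _, by rw [h, baseEntry_idx], by rw [baseEntry_q]⟩⟩
    · exact absurd ((T.act_eq_empty_iff q).1 (Set.eq_empty_iff_forall_notMem.2 h)) hs
  · refine ⟨e, h1, h2, fun s => ?_⟩
    obtain ⟨w', hw', -, hs, hc⟩ := h5 s
    exact ⟨w', hw', hs, hc.1⟩

theorem WellFormed.succ_congr {W : List (Entry n m)} (hW : WellFormed A T F W) {w : Entry n m}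
    (hw : w ∈ W) {s s' : Fin n} (h : A.simE s s') : w.succ s = w.succ s' := by
  obtain ⟨q, rfl⟩ | ⟨e, fam', -, -, -, h4, -⟩ := hW.justified w hw
  · obtain ⟨e, he, heq⟩ | ⟨-, heq⟩ := baseEntry_cases (A := A) (T := T) q <;> rw [heq]
    exact congrArg (fun x => (T.next q (e, x) : ℕ)) (Quotient.sound h)
  · exact h4 s s' h

theorem WellFormed.succ_lt {W : List (Entry n m)} (hW : WellFormed A T F W) {w : Entry n m}
    (hw : w ∈ W) (s : Fin n) : w.succ s < W.length := by
  obtain ⟨q, rfl⟩ | ⟨e, fam', -, -, -, -, h5⟩ := hW.justified w hw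
  · obtain ⟨e, he, heq⟩ | ⟨-, heq⟩ := baseEntry_cases (A := A) (T := T) q
    · rw [heq]
      have := hW.idx_lt (hW.base_mem (T.next q (e, Quotient.mk A.simE s)))
      rwa [baseEntry_idx] at this
    · rw [heq]
      exact (Nat.zero_le _).trans_lt (hW.idx_lt hw)
  · obtain ⟨w', hw', -, hs, -⟩ := h5 s
    exact hs ▸ hW.idx_lt hw'

theorem WellFormed.act_lt {W : List (Entry n m)} (hW : WellFormed A T F W) {w : Entry n m}
    (hw : w ∈ W) (ha : 0 < a) : w.act < a := by
  obtain ⟨q, rfl⟩ | ⟨e, fam', -, h2, -, -, -⟩ := hW.justified w hw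
  · obtain ⟨e, he, heq⟩ | ⟨-, heq⟩ := baseEntry_cases (A := A) (T := T) q
    · rw [heq]
      exact e.2
    · rw [heq]
      exact ha
  · exact h2 ▸ e.2

theorem coverIdx_le (W : List (Entry n m)) (hW : WellFormed A T F W) (q : Fin m)
    (fam : List (List (Fin n))) (s : Fin n) : coverIdx A W q fam s ≤ W.length := by
  obtain ⟨w, hw, -, h⟩ | ⟨-, h⟩ := List.lastSat_cases (p := Covers A q s fam) (f := Entry.idx)
    (d := 0) W
  · exact h.trans_le (hW.idx_lt hw).le
  · exact h.trans_le (Nat.zero_le _)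

theorem memoryEntries_succ_lt {w : Entry n m} (hw : w ∈ memoryEntries A T K F) (s : Fin n) :
    w.succ s < (memoryEntries A T K F).length := by
  rw [memoryEntries, List.length_append, List.length_singleton]
  obtain hw | hw := List.mem_append.1 hw
  · exact (wellFormed_attractor.succ_lt hw s).trans (Nat.lt_succ_self _)
  · obtain rfl := List.mem_singleton.1 hw
    exact Nat.lt_succ_of_le (coverIdx_le _ wellFormed_attractor _ _ _)

theorem memoryEntries_act_lt {w : Entry n m} (hw : w ∈ memoryEntries A T K F) (ha : 0 < a) :
    w.act < a := by
  obtain hw | hw := List.mem_append.1 hw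
  · exact wellFormed_attractor.act_lt hw ha
  · obtain rfl := List.mem_singleton.1 hw
    exact ha

theorem memoryEntries_succ_congr {w : Entry n m} (hw : w ∈ memoryEntries A T K F) {s s' : Fin n}
    (h : A.simE s s') : w.succ s = w.succ s' := by
  obtain hw | hw := List.mem_append.1 hw
  · exact wellFormed_attractor.succ_congr hw h
  · obtain rfl := List.mem_singleton.1 hw
    exact coverIdx_congr h _

variable (A T K F) in
/-- The strategy described by the entries. An observed class is read through a representative. -/
def attractorMemory (ha : 0 < a) :
    MemoryAutomaton A.simE (Fin a) (memoryEntries A T K F).length where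
  init := ⟨(attractor A T F).length, by simp [memoryEntries]⟩
  next i x := ⟨(memoryEntries A T K F)[i].succ x.out,
    memoryEntries_succ_lt (List.getElem_mem _) _⟩
  out i := ⟨(memoryEntries A T K F)[i].act, memoryEntries_act_lt (List.getElem_mem _) ha⟩

theorem attractorMemory_next (ha : 0 < a) (i : Fin (memoryEntries A T K F).length) (s : Fin n) :
    ((attractorMemory A T K F ha).next i (Quotient.mk A.simE s) : ℕ) =
      (memoryEntries A T K F)[i].succ s :=
  memoryEntries_succ_congr (List.getElem_mem _) (Quotient.mk_out (s := A.simE) s)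

/-- The memory state after the observations `x` is the entry `w` of the attractor. -/
def AtEntry (ha : 0 < a) (x : List (Quotient A.simE)) (w : Entry n m) : Prop :=
  w ∈ attractor A T F ∧ ((x.foldl (attractorMemory A T K F ha).next
    (attractorMemory A T K F ha).init : Fin _) : ℕ) = w.idx

theorem AtEntry.getElem {ha : 0 < a} {x : List (Quotient A.simE)} {w : Entry n m}
    (h : AtEntry (T := T) (K := K) (F := F) ha x w) :
    (memoryEntries A T K F)[x.foldl (attractorMemory A T K F ha).next
      (attractorMemory A T K F ha).init] = w := by
  have h1 := wellFormed_attractor.getElem?_idx h.1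
  have h2 : (memoryEntries A T K F)[w.idx]? = some w := by
    rw [memoryEntries, List.getElem?_append_left (wellFormed_attractor.idx_lt h.1), h1]
  rw [← h.2] at h2
  exact (List.getElem?_eq_some_iff.1 h2).2

theorem AtEntry.strategy {ha : 0 < a} {x : List (Quotient A.simE)} {w : Entry n m}
    (h : AtEntry (T := T) (K := K) (F := F) ha x w) :
    (((attractorMemory A T K F ha).strategy x : Fin a) : ℕ) = w.act :=
  congrArg Entry.act h.getElem

theorem AtEntry.snoc {ha : 0 < a} {x : List (Quotient A.simE)} {w w' : Entry n m} {s : Fin n}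
    (h : AtEntry (T := T) (K := K) (F := F) ha x w) (hw' : w' ∈ attractor A T F)
    (hs : w.succ s = w'.idx) :
    AtEntry (T := T) (K := K) (F := F) ha (x ++ [Quotient.mk A.simE s]) w' := by
  refine ⟨hw', ?_⟩
  rw [List.foldl_append, List.foldl_cons, List.foldl_nil, attractorMemory_next, h.getElem, hs]

theorem exists_atEntry_start (h : Solvable A T K F) (s : Fin n) : ∃ w,
    AtEntry (T := T) (K := K) (F := F) h.1 [Quotient.mk A.simE s] w ∧
      Covers A T.init s (initFam K) w := by
  obtain ⟨w, hw, hc, hi⟩ := exists_coverIdx_eq (h.2 s)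
  refine ⟨w, ⟨hw, ?_⟩, hc⟩
  rw [List.foldl_cons, List.foldl_nil, attractorMemory_next, ← hi]
  simp [attractorMemory, memoryEntries]

theorem exists_fam_of_covers_initFam {s : Fin n} {w : Entry n m} (hs : s ∈ K)
    (hc : Covers A T.init s (initFam K) w) : ∃ Y ∈ w.fam, ∀ t, t ∈ Y ↔ t = s := by
  obtain ⟨Y, hY, h⟩ := hc.2 [s] (mem_initFam.2 ⟨s, hs, rfl⟩) ⟨s, by simp, A.simE.refl s⟩
  exact ⟨Y, hY, fun t => by simpa using (h t).symm⟩

theorem attractorMemory_compatible (h : Solvable A T K F) :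
    A.Compatible T K (attractorMemory A T K F h.1).strategy := by
  have key : ∀ l : PartialPlay (Fin n) (Fin a) (Fin b), l.first ∈ K →
      l.EveRespects A (attractorMemory A T K F h.1).strategy →
      ∃ w, AtEntry (T := T) (K := K) (F := F) h.1 (l.obs A.simE) w ∧ w.q = T.stateAfter l ∧
        T.stateAfter l ≠ T.sink := by
    intro l hl hr
    induction l with
    | start s =>
      obtain ⟨w, hw, hc⟩ := exists_atEntry_start h s
      obtain ⟨Y, hY, -⟩ := exists_fam_of_covers_initFam hl hc
      obtain ⟨e, -, he, -⟩ := (wellFormed_attractor.justified w hw.1).of_fam_ne_nil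
        (List.ne_nil_of_mem hY)
      exact ⟨w, hw, hc.1, by
        rw [ActionAutomaton.stateAfter, ← hc.1]
        exact ActionAutomaton.ne_sink_of_mem_Act he⟩
    | snoc l e c s ih =>
      obtain ⟨w, hw, hq, hsink⟩ := ih hl hr.1
      obtain ⟨e', he', hact, hsucc⟩ := wellFormed_attractor.act_mem hw.1 (hq ▸ hsink)
      obtain rfl : e = e' := Fin.ext <| by rw [hr.2, hw.strategy, hact]
      obtain ⟨w', hw', hs, hq'⟩ := hsucc s
      exact ⟨w', hw.snoc hw' hs, by rw [hq', hq]; rfl, by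
        rw [ActionAutomaton.stateAfter, ← hq]
        exact ActionAutomaton.next_ne_sink he' _⟩
  intro l hl _ hr
  obtain ⟨w, hw, hq, hsink⟩ := key l hl hr
  obtain ⟨e, he, hact, -⟩ := wellFormed_attractor.act_mem hw.1 (hq ▸ hsink)
  have : (attractorMemory A T K F h.1).strategy (l.obs A.simE) = e :=
    Fin.ext <| by rw [hw.strategy, hact]
  rw [this, ← hq]
  exact he

/-- If Adam's belief is an obligation of the current memory state, then some play reaches `F`.
The belief is realised by plays `h` that Adam cannot distinguish. -/
theorem exists_reach_of_atEntry (hA : A.AdamMoreInformed) (ha : 0 < a) (ψ : A.AdamStrategy)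
    (s₀ : Fin n) {w : Entry n m} {x : List (Quotient A.simE)} {y : List (Quotient A.simA)}
    (hw : AtEntry (T := T) (K := K) (F := F) ha x w) {B : List (Fin n)} (hB : B ∈ w.fam)
    (hreal : ∀ s ∈ B, ∃ (h : ℕ → Fin n) (k : ℕ), h 0 = s₀ ∧
      (∀ i < k, A.StepPossible (attractorMemory A T K F ha).strategy ψ h i) ∧ h k = s ∧
      Arena.obsHistory A.simE k (fun i => h i) = x ∧
      Arena.obsHistory A.simA k (fun i => h i) = y) :
    ∃ (h : ℕ → Fin n) (k : ℕ), h 0 = s₀ ∧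
      (∀ i < k, A.StepPossible (attractorMemory A T K F ha).strategy ψ h i) ∧ h k ∈ F := by
  induction hidx : w.idx using Nat.strong_induction_on generalizing w x y B with
  | _ N ih =>
  obtain ⟨e, fam', he, hact, hsec, hsucc⟩ :=
    (wellFormed_attractor.justified w hw.1).of_fam_ne_nil (List.ne_nil_of_mem hB)
  obtain ⟨s, hs, hsF⟩ | hsec := hsec B hB
  · obtain ⟨h, k, h0, hk, rfl, -⟩ := hreal s hs
    exact ⟨h, k, h0, hk, hsF⟩
  obtain ⟨s', hs', X, hX, hXs⟩ := hsec (ψ y)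
  obtain ⟨w', hw', hlt, hidx', hc⟩ := hsucc s'
  obtain ⟨Y, hY, hXY⟩ := hc.2 X hX ⟨s', (hXs s').2 ⟨A.simA.refl s', hs'⟩, A.simE.refl s'⟩
  refine ih w'.idx (hidx ▸ hlt) (hw.snoc hw' hidx') (y := y ++ [Quotient.mk A.simA s']) hY
    (fun t ht => ?_) rfl
  obtain ⟨hst, r, hr, hδ⟩ := (hXs t).1 ((hXY t).2 ht)
  obtain ⟨h, k, h0, hk, rfl, hE, hA'⟩ := hreal r hr
  have hφ : (attractorMemory A T K F ha).strategy x = e := Fin.ext <| by rw [hw.strategy, hact]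
  -- the play `h`, continued by `t`
  set h' : ℕ → Fin n := fun i => if i ≤ k then h i else t with hdef
  have hh' : ∀ i ≤ k, h i = h' i := fun i hi => by simp [hdef, hi]
  have ht' : h' (k + 1) = t := by simp [hdef]
  refine ⟨h', k + 1, by rw [← hh' 0 (Nat.zero_le k), h0], fun i hi => ?_, ht', ?_, ?_⟩
  · obtain hi | rfl := Nat.lt_succ_iff_lt_or_eq.1 hi
    · exact (hk i hi).congr fun j hj => hh' j (by omega)
    · rw [Arena.StepPossible, ← Arena.obsHistory_congr A.simE hh',
        ← Arena.obsHistory_congr A.simA hh', hE, hA', hφ, ht', ← hh' i le_rfl]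
      exact pos_iff_ne_zero.2 hδ
  · rw [Arena.obsHistory_succ, ← Arena.obsHistory_congr A.simE hh', hE, ht',
      Quotient.sound (A.simE.symm (hA _ _ hst))]
  · rw [Arena.obsHistory_succ, ← Arena.obsHistory_congr A.simA hh', hA', ht',
      Quotient.sound (A.simA.symm hst)]

theorem attractorMemory_positivelyWinning (hA : A.AdamMoreInformed) (h : Solvable A T K F) :
    A.PositivelyWinning K F (attractorMemory A T K F h.1).strategy := by
  intro s₀ hs₀ ψ
  obtain ⟨w, hw, hc⟩ := exists_atEntry_start h s₀
  obtain ⟨Y, hY, hYs⟩ := exists_fam_of_covers_initFam hs₀ hc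
  obtain ⟨p, k, h0, hk, hF⟩ := exists_reach_of_atEntry hA h.1 ψ s₀ hw hY
    (y := [Quotient.mk A.simA s₀]) fun s hs => by
      obtain rfl := (hYs s).1 hs
      exact ⟨fun _ => s, 0, rfl, by simp, rfl,
        Arena.obsHistory_zero _ fun _ => s, Arena.obsHistory_zero _ fun _ => s⟩
  exact Arena.prob_reach_pos h0 hk hF

end Soundness

/-! ### A winning strategy puts the initial positions into the attractor -/

section Completeness

variable {n a b m : ℕ} {A : Arena (Fin n) (Fin a) (Fin b)}
  {T : ActionAutomaton A.simE (Fin a) (Fin m)} {K F : Set (Fin n)}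

variable (A) in
/-- The belief of Adam after he had the belief `B`, the players have chosen `e` and `c`, and Adam
has observed the class of `s'`. -/
def nextBelief (B : Set (Fin n)) (e : Fin a) (c : Fin b) (s' : Fin n) : Set (Fin n) :=
  {s | A.simA s' s ∧ ∃ r ∈ B, A.δ r e c s ≠ 0}

variable (F) in
/-- Eve's strategy `φ` defeats the belief `B` of Adam after the observations `x`, within less than
`N` steps. -/
def WinsWithin (φ : A.EveStrategy) : ℕ → List (Quotient A.simE) → Set (Fin n) → Prop
  | 0, _, _ => False
  | N + 1, x, B => (∃ s ∈ B, s ∈ F) ∨ ∀ c, ∃ s', (∃ r ∈ B, A.δ r (φ x) c s' ≠ 0) ∧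
      WinsWithin φ N (x ++ [Quotient.mk A.simE s']) (nextBelief A B (φ x) c s')

theorem WinsWithin.succ {φ : A.EveStrategy} {N : ℕ} : ∀ {x : List (Quotient A.simE)}
    {B : Set (Fin n)}, WinsWithin F φ N x B → WinsWithin F φ (N + 1) x B := by
  induction N with
  | zero => exact fun h => h.elim
  | succ N ih => exact fun h => h.imp_right fun h c =>
      let ⟨s', hs', h'⟩ := h c
      ⟨s', hs', ih h'⟩

theorem WinsWithin.mono {φ : A.EveStrategy} {N N' : ℕ} (hN : N ≤ N') {x : List (Quotient A.simE)}
    {B : Set (Fin n)} (h : WinsWithin F φ N x B) : WinsWithin F φ N' x B := by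
  induction hN with
  | refl => exact h
  | step _ ih => exact ih.succ

/-- If `φ` does not defeat the belief `B` within a bounded time, then Adam has an action that
leaves him with undefeated beliefs only. As he has only finitely many actions, bounds for each of
them yield a common bound. -/
theorem exists_action_of_not_winsWithin {φ : A.EveStrategy} {x : List (Quotient A.simE)}
    {B : Set (Fin n)} (h : ∀ N, ¬ WinsWithin F φ N x B) :
    (∀ s ∈ B, s ∉ F) ∧ ∃ c, ∀ s', (∃ r ∈ B, A.δ r (φ x) c s' ≠ 0) →
      ∀ N, ¬ WinsWithin F φ N (x ++ [Quotient.mk A.simE s']) (nextBelief A B (φ x) c s') := by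
  refine ⟨fun s hs hF => h 1 (.inl ⟨s, hs, hF⟩), ?_⟩
  by_contra! hc
  choose s' hs' N hN using hc
  exact h (Finset.univ.sup N + 1) (.inr fun c =>
    ⟨s' c, hs' c, (hN c).mono (Finset.le_sup (Finset.mem_univ c))⟩)

open Classical in
/-- An action of Adam that keeps the belief `B` undefeated, if there is one. -/
def evade (F : Set (Fin n)) (φ : A.EveStrategy) (c₀ : Fin b)
    (p : List (Quotient A.simE) × Set (Fin n)) : Fin b :=
  if h : ∀ N, ¬ WinsWithin F φ N p.1 p.2 then (exists_action_of_not_winsWithin h).2.choose else c₀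

/-- Adam's update of Eve's observations and of his own belief, if he follows `evade`. -/
def evadeStep (F : Set (Fin n)) (φ : A.EveStrategy) (c₀ : Fin b)
    (p : List (Quotient A.simE) × Set (Fin n)) (y : Quotient A.simA) :
    List (Quotient A.simE) × Set (Fin n) :=
  (p.1 ++ [Quotient.mk A.simE y.out], nextBelief A p.2 (φ p.1) (evade F φ c₀ p) y.out)

theorem evadeStep_mk (hA : A.AdamMoreInformed) {φ : A.EveStrategy} {c₀ : Fin b}
    {p : List (Quotient A.simE) × Set (Fin n)} (s : Fin n) :
    evadeStep F φ c₀ p (Quotient.mk A.simA s) =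
      (p.1 ++ [Quotient.mk A.simE s], nextBelief A p.2 (φ p.1) (evade F φ c₀ p) s) := by
  have h : A.simA (Quotient.mk A.simA s).out s := Quotient.mk_out (s := A.simA) s
  unfold evadeStep nextBelief
  rw [Quotient.sound (hA _ _ h)]
  have : ∀ t, A.simA (Quotient.mk A.simA s).out t ↔ A.simA s t := fun t =>
    ⟨A.simA.trans (A.simA.symm h), A.simA.trans h⟩
  simp only [this]

/-- A positively winning strategy defeats each initial belief within a bounded time. -/
theorem exists_winsWithin (hA : A.AdamMoreInformed) {φ : A.EveStrategy}
    (hφ : A.PositivelyWinning K F φ) {s₀ : Fin n} (hs₀ : s₀ ∈ K) :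
    ∃ N, WinsWithin F φ N [Quotient.mk A.simE s₀] {s₀} := by
  by_contra! hne
  obtain ⟨-, c₀, -⟩ := exists_action_of_not_winsWithin hne
  let p₀ : List (Quotient A.simE) × Set (Fin n) := ([Quotient.mk A.simE s₀], {s₀})
  -- Adam knows the initial state, so that his first observation is not processed
  let track : List (Quotient A.simA) → List (Quotient A.simE) × Set (Fin n) := fun y =>
    y.tail.foldl (evadeStep F φ c₀) p₀
  let ψ : A.AdamStrategy := fun y => evade F φ c₀ (track y)
  obtain ⟨ω, h0, hstep, k, hk⟩ := Arena.exists_play_of_prob_pos (hφ s₀ hs₀ ψ)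
  have key : ∀ k, (track (Arena.obsHistory A.simA k fun i => ω i)).1 =
        Arena.obsHistory A.simE k (fun i => ω i) ∧
      ω k ∈ (track (Arena.obsHistory A.simA k fun i => ω i)).2 ∧
      ∀ N, ¬ WinsWithin F φ N (track (Arena.obsHistory A.simA k fun i => ω i)).1
        (track (Arena.obsHistory A.simA k fun i => ω i)).2 := by
    intro k
    induction k with
    | zero =>
      rw [Arena.obsHistory_zero, Arena.obsHistory_zero, h0]
      exact ⟨rfl, rfl, hne⟩
    | succ k ih =>
      obtain ⟨h1, h2, h3⟩ := ih
      have hne' : Arena.obsHistory A.simA k (fun i => ω i) ≠ [] := by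
        simp [Arena.obsHistory]
      have htrack : track (Arena.obsHistory A.simA (k + 1) fun i => ω i) =
          evadeStep F φ c₀ (track (Arena.obsHistory A.simA k fun i => ω i))
            (Quotient.mk A.simA (ω (k + 1))) := by
        rw [Arena.obsHistory_succ]
        change List.foldl _ _ (List.tail _) = _
        rw [List.tail_append_of_ne_nil hne', List.foldl_append]
        rfl
      have hs := hstep k
      rw [Arena.StepPossible, ← h1] at hs
      have hs' := hs.ne'
      rw [htrack, evadeStep_mk hA]
      refine ⟨by rw [h1, Arena.obsHistory_succ], ⟨A.simA.refl _, _, h2, hs'⟩, ?_⟩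
      have hev : evade F φ c₀ (track (Arena.obsHistory A.simA k fun i => ω i)) =
          (exists_action_of_not_winsWithin h3).2.choose := dif_pos h3
      refine hev ▸ (exists_action_of_not_winsWithin h3).2.choose_spec _ ⟨_, h2, ?_⟩
      rw [← hev]
      exact hs'
  exact (exists_action_of_not_winsWithin (key k).2.2).1 _ (key k).2.1 hk

/-- Every set of states is represented by a list from the table of all sets. -/
theorem exists_list_eq (B : Set (Fin n)) :
    ∃ X ∈ (List.finRange n).powList, {s | s ∈ X} = B := by
  obtain ⟨X, hX, h⟩ := List.exists_mem_powList (List.finRange n) (· ∈ B)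
  exact ⟨X, hX, Set.ext fun s => by simpa using h s⟩

/-- Every family of sets of states is represented by a list from the table of all families. -/
theorem exists_family_eq (P : Set (Set (Fin n))) :
    ∃ fam ∈ families n, ∀ X, X ∈ fam ↔ X ∈ (List.finRange n).powList ∧ {s | s ∈ X} ∈ P :=
  List.exists_mem_powList _ fun X => {s | s ∈ X} ∈ P

/-- The states in `B` can be reached from `K` by plays that respect `φ` and in which Eve's
observations are `x`. -/
def Realised (K : Set (Fin n)) (φ : A.EveStrategy) (x : List (Quotient A.simE))
    (B : Set (Fin n)) : Prop :=
  ∀ s ∈ B, ∃ l : PartialPlay (Fin n) (Fin a) (Fin b), l.first ∈ K ∧ l.IsPlay A ∧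
    l.EveRespects A φ ∧ l.obs A.simE = x ∧ l.last = s

/-- If `φ` defeats all beliefs of a family within less than `N` steps, then the attractor covers the family:
by induction on `N`, it covers the family of the beliefs to which the next step leads. -/
theorem exists_entry_of_winsWithin (hA : A.AdamMoreInformed) {φ : A.EveStrategy}
    (hφ : A.Compatible T K φ) (N : ℕ) : ∀ {x : List (Quotient A.simE)} {q : Fin m},
    x ≠ [] →
    (∀ l : PartialPlay (Fin n) (Fin a) (Fin b), l.EveRespects A φ → l.obs A.simE = x →
      T.stateAfter l = q) →
    ∀ P : Set (Set (Fin n)), (∀ B ∈ P, B.Nonempty ∧ Realised K φ x B ∧ WinsWithin F φ N x B) →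
    ∃ w ∈ attractor A T F, w.q = q ∧ ∀ B ∈ P, ∃ Y ∈ w.fam, {s | s ∈ Y} = B := by
  induction N with
  | zero =>
    exact fun _ _ P hP => ⟨_, wellFormed_attractor.base_mem _, baseEntry_q _,
      fun B hB => (hP B hB).2.2.elim⟩
  | succ N ih =>
    intro x q hx hq P hP
    obtain rfl | ⟨B₀, hB₀⟩ := P.eq_empty_or_nonempty
    · exact ⟨_, wellFormed_attractor.base_mem _, baseEntry_q _, by simp⟩
    obtain ⟨⟨s₀, hs₀⟩, hR₀, -⟩ := hP B₀ hB₀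
    obtain ⟨l₀, hK₀, hp₀, hr₀, hl₀, -⟩ := hR₀ s₀ hs₀
    have hact : φ x ∈ T.Act q := by
      have := hφ l₀ hK₀ hp₀ hr₀
      rwa [hl₀, hq l₀ hr₀ hl₀] at this
    -- the beliefs that may arise in the next step and that `φ` defeats in less than `N` steps
    let P' : Set (Set (Fin n)) := {B' | ∃ B ∈ P, ∃ c s', (∃ r ∈ B, A.δ r (φ x) c s' ≠ 0) ∧
      B' = nextBelief A B (φ x) c s' ∧ WinsWithin F φ N (x ++ [Quotient.mk A.simE s']) B'}
    obtain ⟨fam, hfam, hfamP⟩ := exists_family_eq P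
    obtain ⟨fam', hfam', hfamP'⟩ := exists_family_eq P'
    have hmove : CanMove A T F (attractor A T F) q fam (φ x) fam' := by
      refine ⟨hact, fun X hX => ?_, fun s => ?_⟩
      · have hXP := ((hfamP X).1 hX).2
        refine (hP _ hXP).2.2.imp (fun h => h) fun h c => ?_
        obtain ⟨s', hs', hw⟩ := h c
        obtain ⟨Y, hY, hYB⟩ := exists_list_eq (nextBelief A {s | s ∈ X} (φ x) c s')
        exact ⟨s', hs', Y, (hfamP' Y).2 ⟨hY, _, hXP, c, s', hs', hYB, hYB ▸ hw⟩,
          fun s => Set.ext_iff.1 hYB s⟩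
      · obtain ⟨w, hw, hwq, hwP⟩ : ∃ w ∈ attractor A T F,
            w.q = T.next q (φ x, Quotient.mk A.simE s) ∧
            ∀ B ∈ {B' ∈ P' | ∃ t ∈ B', A.simE s t}, ∃ Y ∈ w.fam, {s | s ∈ Y} = B := by
          refine ih (x := x ++ [Quotient.mk A.simE s]) (by simp) (fun l hr hl => ?_) _ ?_
          · cases l with
            | start s =>
              have : x.length = 0 := by
                simpa [PartialPlay.obs] using (congrArg List.length hl).symm
              exact absurd (List.length_eq_zero_iff.1 this) hx
            | snoc l e c s' =>
              obtain ⟨h1, h2⟩ := List.append_inj' hl rfl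
              rw [ActionAutomaton.stateAfter, hq l hr.1 h1, hr.2, h1, List.singleton_inj.1 h2]
          · rintro B' ⟨⟨B, hB, c, s', hs', rfl, hw⟩, t, ht, hst⟩
            have hclass : ∀ t' ∈ nextBelief A B (φ x) c s',
                Quotient.mk A.simE t' = Quotient.mk A.simE s' := fun t' ht' =>
              Quotient.sound (A.simE.symm (hA _ _ ht'.1))
            have hs : Quotient.mk A.simE s = Quotient.mk A.simE s' :=
              (Quotient.sound hst).trans (hclass t ht)
            refine ⟨⟨t, ht⟩, fun t' ht' => ?_, hs ▸ hw⟩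
            obtain ⟨l, hK, hp, hre, hl, hlast⟩ := (hP B hB).2.1 _ ht'.2.choose_spec.1
            exact ⟨.snoc l (φ x) c t', hK, ⟨hp, pos_iff_ne_zero.2 (hlast ▸ ht'.2.choose_spec.2)⟩,
              ⟨hre, by rw [hl]⟩, by rw [PartialPlay.obs, hl, hclass t' ht', hs], rfl⟩
        refine ⟨w, hw, hwq, fun X hX ⟨t, ht, hst⟩ => ?_⟩
        obtain ⟨Y, hY, hYX⟩ := hwP {s | s ∈ X} ⟨((hfamP' X).1 hX).2, t, ht, hst⟩
        exact ⟨Y, hY, fun t => (Set.ext_iff.1 hYX t).symm⟩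
    obtain ⟨w, hw, hwq, hwf⟩ := isClosedAttr_attractor (q, fam) (mem_positions.2 hfam) _ _ hfam'
      hmove
    refine ⟨w, hw, hwq, fun B hB => ?_⟩
    obtain ⟨Y, hY, rfl⟩ := exists_list_eq B
    exact ⟨Y, hwf ▸ (hfamP Y).2 ⟨hY, hB⟩, rfl⟩

theorem solvable_of_eveWins (hA : A.AdamMoreInformed) (h : EveWins A T K F) :
    Solvable A T K F := by
  obtain ⟨φ, hc, hw⟩ := h
  refine ⟨(φ []).pos, fun s => ?_⟩
  have hN : ∀ t : Fin n, ∃ N, t ∈ K → WinsWithin F φ N [Quotient.mk A.simE t] {t} := fun t => by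
    by_cases ht : t ∈ K
    · exact (exists_winsWithin hA hw ht).imp fun _ h _ => h
    · exact ⟨0, fun h => absurd h ht⟩
  choose N hN using hN
  obtain ⟨w, hw, hq, hwP⟩ : ∃ w ∈ attractor A T F, w.q = T.init ∧
      ∀ B ∈ {B | ∃ t ∈ K, A.simE s t ∧ B = {t}}, ∃ Y ∈ w.fam, {s | s ∈ Y} = B := by
    refine exists_entry_of_winsWithin hA hc (Finset.univ.sup N) (x := [Quotient.mk A.simE s])
      (by simp) (fun l hr hl => ?_) _ ?_
    · cases l with
      | start s => rfl
      | snoc l e c s' =>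
        have hlen : (l.obs A.simE).length = 0 := by
          simpa [PartialPlay.obs] using congrArg List.length hl
        cases l <;> simp [PartialPlay.obs] at hlen
    · rintro B ⟨t, ht, hst, rfl⟩
      rw [(Quotient.sound hst : Quotient.mk A.simE s = Quotient.mk A.simE t)]
      refine ⟨Set.singleton_nonempty t, ?_, (hN t ht).mono (Finset.le_sup (Finset.mem_univ t))⟩
      rintro _ rfl
      exact ⟨.start _, ht, trivial, trivial, rfl, rfl⟩
  refine ⟨w, hw, hq, fun X hX ⟨t, ht, hst⟩ => ?_⟩
  obtain ⟨t', ht', rfl⟩ := mem_initFam.1 hX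
  obtain rfl := List.mem_singleton.1 ht
  obtain ⟨Y, hY, hYt⟩ := hwP {t} ⟨t, ht', hst, rfl⟩
  exact ⟨Y, hY, fun u => by simpa using (Set.ext_iff.1 hYt u).symm⟩

theorem solvable_iff_eveWins (hA : A.AdamMoreInformed) :
    Solvable A T K F ↔ EveWins A T K F :=
  ⟨fun h => ⟨_, attractorMemory_compatible h, attractorMemory_positivelyWinning hA h⟩,
    solvable_of_eveWins hA⟩

end Completeness

/-! ### The two programs -/

theorem Inst.output_eq (g : Inst) (ha : 0 < g.a) :
    g.output = encodeMemory (attractorMemory g.A g.T g.K g.F ha) := by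
  unfold Inst.output encodeMemory Data.table
  have h1 : (memoryEntries g.A g.T g.K g.F).map (fun w => Data.table fun s => .ofNat (w.succ s)) =
      List.ofFn fun i => Data.table fun s =>
        .ofNat ((attractorMemory g.A g.T g.K g.F ha).next i (Quotient.mk g.A.simE s) : ℕ) := by
    simp only [attractorMemory_next]
    exact (List.ofFn_getElem_eq_map _ _).symm
  have h2 : (memoryEntries g.A g.T g.K g.F).map (fun w => Data.ofNat w.act) =
      List.ofFn fun i => Data.ofNat ((attractorMemory g.A g.T g.K g.F ha).out i : ℕ) :=
    (List.ofFn_getElem_eq_map _ _).symm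
  unfold Data.table at h1
  rw [h1, h2]
  rfl

theorem mainTheorem2 :
    ∃ (decider builder : Prog) (C d : ℕ),
      ∀ code : ℝ≥0∞ → Data, (∀ p, code p = Data.nil ↔ p = 0) →
      ∀ (n a b m : ℕ) (A : Arena (Fin n) (Fin a) (Fin b))
        (T : ActionAutomaton A.simE (Fin a) (Fin m)) (K F : Set (Fin n)),
        A.AdamMoreInformed →
        (∃ t ≤ C * (2 ^ 2 ^ n + m + a + b) ^ d,
          Run decider (encodeGame code A T K F) (Data.ofProp (EveWins A T K F)) t) ∧
        (EveWins A T K F →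
          ∃ (k t : ℕ) (M : MemoryAutomaton A.simE (Fin a) k),
            k ≤ C * (2 ^ 2 ^ n * m) ^ d ∧
            A.Compatible T K M.strategy ∧
            A.PositivelyWinning K F M.strategy ∧
            Run builder (encodeGame code A T K F) (encodeMemory M) t) := by
  obtain ⟨D, TD, ⟨d, hd⟩, hD⟩ := polyComp_solvable (g := fun g : Inst => g) PolyComp.env
  obtain ⟨B, TB, -, hB⟩ := polyComp_output (g := fun g : Inst => g) PolyComp.env
  -- the running time is at most `(N + 2) ^ d ≤ (2 * N) ^ d`, and the number of memory states at
  -- most `m + p ^ 2 + 1 ≤ 3 * p ^ 2`, where `p = 2 ^ 2 ^ n * m` is the number of positions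
  refine ⟨D, B, 2 ^ d + 3, d + 2, fun code hcode n a b m A T K F hA => ?_⟩
  let g : Inst := ⟨code, hcode, n, a, b, m, A, T, K, F⟩
  constructor
  · obtain ⟨t, ht, hrun⟩ := hD g
    refine ⟨t, ht.trans ((hd g).trans ?_), ?_⟩
    · change (2 ^ 2 ^ n + m + a + b + 2) ^ d ≤ _
      set N := 2 ^ 2 ^ n + m + a + b
      have h2 : 2 ≤ N := by
        have : 2 ^ 1 ≤ 2 ^ 2 ^ n := Nat.pow_le_pow_right (by norm_num) Nat.one_le_two_pow
        omega
      calc (N + 2) ^ d ≤ (2 * N) ^ d := Nat.pow_le_pow_left (by omega) d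
        _ = 2 ^ d * N ^ d := mul_pow _ _ _
        _ ≤ (2 ^ d + 3) * N ^ (d + 2) :=
          Nat.mul_le_mul (by omega) (Nat.pow_le_pow_right (by omega) (by omega))
    · rw [← propext (solvable_iff_eveWins hA)]
      exact hrun
  · intro hwin
    have hs := solvable_of_eveWins hA hwin
    obtain ⟨t, -, hrun⟩ := hB g
    refine ⟨_, t, attractorMemory A T K F hs.1, ?_, attractorMemory_compatible hs,
      attractorMemory_positivelyWinning hA hs, ?_⟩
    · rw [memoryEntries, List.length_append, List.length_singleton]
      have hlen : (attractor A T F).length ≤ _ := length_attractor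
      have hm : 1 ≤ m := T.init.pos
      have h2 : 1 ≤ 2 ^ 2 ^ n := Nat.one_le_two_pow
      set p := 2 ^ 2 ^ n
      have h3 : 1 ≤ p * m := Nat.mul_pos h2 hm
      have h4 : m ≤ p * m := Nat.le_mul_of_pos_left m h2
      have h5 : p * m ≤ (p * m) ^ 2 := Nat.le_self_pow (by norm_num) _
      have h6 : m * p * (m * p) = (p * m) ^ 2 := by ring
      calc (attractor A T F).length + 1 ≤ 3 * (p * m) ^ 2 := by omega
        _ ≤ (2 ^ d + 3) * (p * m) ^ (d + 2) :=
          Nat.mul_le_mul (Nat.le_add_left 3 _) (Nat.pow_le_pow_right h3 (by omega))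
    · rw [← g.output_eq hs.1]
      exact hrun

end
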